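/- **Theorem 3.2.** Let $1\le k\le n$ and $\rho>0$. Put $J_{2m}=\begin{bmatrix}0&I_m\\-I_m&0\end{bmatrix}$, $\mathrm{sym}(A)=\frac12(A+A^T)$, $\mathrm{skew}(A)=\frac12(A-A^T)$, and consider the symplectic Stiefel manifold $$\mathrm{Sp}(2k,2n)=\{X\in\mathbb R^{2n\times 2k}: X^TJ_{2n}X=J_{2k}\},\qquad \mathrm T_X\mathrm{Sp}(2k,2n)=\{Z\in\mathbb R^{2n\times 2k}: X^TJ_{2n}Z+Z^TJ_{2n}X=0\}.$$ For each $X\in\mathrm{Sp}(2k,2n)$ choose $X_\perp\in\mathbb R^{2n\times(2n-2k)}$ of full rank with $X^TX_\perp=0$ such that the columns of $X_\perp(X_\perp^TJ_{2n}X_\perp)^{-1}$ are orthonormal, and equip $\mathrm{Sp}(2k,2n)$ with the canonical-like metric $$g_X(Z_1,Z_2)=\mathrm{tr}(Z_1^T M_{X}Z_2),\qquad M_{X}=\tfrac1\rho J_{2n}XX^TJ_{2n}^T-X_\perp(X_\perp^TJ_{2n}X_\perp)^{-2}X_\perp^T .$$ Put $$\mathcal P_{X,c}(Y)=Y-XJ_{2k}\,\mathrm{skew}(X^TJ_{2n}^TY),\qquad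 P_X=I_{2n}-XJ_{2k}X^TJ_{2n}^T .$$ Let $f:\mathrm{Sp}(2k,2n)\to\mathbb R$ be of class $C^2$. Then: (a) the metric $g$ has a Riemannian (Levi-Civita) connection $\nabla$, and $f$ has a Riemannian gradient $\mathrm{grad}_c f$, that is, a tangent vector field with $g_X(\mathrm{grad}_c f(X),Z)=\mathrm Df(X)[Z]$ for all $Z\in\mathrm T_X\mathrm{Sp}(2k,2n)$, and this field is of class $C^1$; hence the Riemannian Hessian $\mathrm{Hess}_c f(X)[Z]=\nabla_Z\,\mathrm{grad}_c f(X)$ is defined; (b) for every $X\in\mathrm{Sp}(2k,2n)$ the matrix $M_X$ is symmetric positive definite, $\mathcal P_{X,c}$ is the $g_X$-orthogonal projection of $\mathbb R^{2n\times 2k}$ onto $\mathrm T_X\mathrm{Sp}(2k,2n)$ (orthogonality being meant for the form $\mathrm{tr}(Y_1^TM_XY_2)$ on $\mathbb R^{2n\times 2k}$), and $P_X$ satisfies $P_X^2=P_X$ and $P_XY\in\mathrm T_X\mathrm{Sp}(2k,2n)$ for all $Y\in\mathbb R^{2n\times 2k}$; (c) for every $X\in\mathrm{Sp}(2k,2n)$,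 every function $\bar f$ on $\mathbb R^{2n\times 2k}$ that is of class $C^2$ near $X$ and agrees with $f$ on $\mathrm{Sp}(2k,2n)$ near $X$, and every $Z\in\mathrm T_X\mathrm{Sp}(2k,2n)$, writing $G=\nabla\bar f(X)$ and $H=\nabla^2\bar f(X)[Z]$ for the Euclidean gradient and Hessian of $\bar f$, $$\begin{aligned} \mathrm{Hess}_c f(X)[Z]={}&\mathcal P_{X,c}\Bigl(M_X^{-1}H-\rho\,ZJ_{2k}\,\mathrm{skew}\bigl(J_{2k}^TX^TG\bigr)+2\,\mathrm{sym}\bigl(\rho\,XZ^T-2\,\mathrm{skew}(XJ_{2k}Z^T)J_{2n}^TP_X^T\bigr)G\\ &\qquad+\rho\,X\,\mathrm{sym}\bigl(X^TJ_{2n}ZG^TXJ_{2k}-Z^TG\bigr)\Bigr)\\ &+P_X\Bigl(P_X^TJ_{2n}\bigl(Z\,\mathrm{sym}(G^TXJ_{2k})+\tfrac1\rho P_X^TGZ^TJ_{2n}X\bigr)-J_{2n}XJ_{2k}\,\mathrm{sym}\bigl(Z^TP_X^TG\bigr)\\ &\qquad-Z\,\mathrm{skew}\bigl(J_{2k}X^TJ_{2n}P_X^TG+\rho\,J_{2k}\,\mathrm{sym}(J_{2k}^TX^TG)\bigr)-P_X^TG\,\mathrm{skew}\bigl((X^TX)^{-1}X^TZ\bigr)\Bigr).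 \end{aligned}$$ -/

import Mathlib

open scoped Matrix Topology

attribute [local instance] Matrix.frobeniusNormedAddCommGroup Matrix.frobeniusNormedSpace

noncomputable section

namespace SymplecticStiefel

/-- The ambient Euclidean space of real `2n × 2k` matrices. -/
abbrev Amb (k n : ℕ) : Type := Matrix (Fin n ⊕ Fin n) (Fin k ⊕ Fin k) ℝ

/-- The `2m × 2m` matrix with blocks `[0, I; -I, 0]`. -/
def J (m : ℕ) : Matrix (Fin m ⊕ Fin m) (Fin m ⊕ Fin m) ℝ :=
  Matrix.fromBlocks 0 1 (-1) 0

/-- Symmetric part of a square matrix. -/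
def symm {ι : Type} (A : Matrix ι ι ℝ) : Matrix ι ι ℝ := (1 / 2 : ℝ) • (A + Aᵀ)

/-- Skew-symmetric part of a square matrix. -/
def skew {ι : Type} (A : Matrix ι ι ℝ) : Matrix ι ι ℝ := (1 / 2 : ℝ) • (A - Aᵀ)

/-- The symplectic Stiefel manifold `Sp(2k,2n)`. -/
def Sp (k n : ℕ) : Set (Amb k n) := {X | Xᵀ * J n * X = J k}

/-- The tangent space to `Sp(2k,2n)` at `X`: the kernel of `Z ↦ Xᵀ J Z + Zᵀ J X`. -/
def TSp {k n : ℕ} (X : Amb k n) : Set (Amb k n) := {Z | Xᵀ * J n * Z + Zᵀ * J n * X = 0}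

/-! ### Calculus on the embedded submanifold -/

/-- `V` is of class `C^r` on `Sp(2k,2n)`: around every point it has a `C^r` extension to a
neighbourhood in the ambient space. Only the values of `V` on `Sp(2k,2n)` matter. -/
def IsCr {k n : ℕ} {F : Type} [NormedAddCommGroup F] [NormedSpace ℝ F] (r : ℕ)
    (V : Amb k n → F) : Prop :=
  ∀ X ∈ Sp k n, ∃ Vbar : Amb k n → F, ContDiffAt ℝ r Vbar X ∧ V =ᶠ[𝓝[Sp k n] X] Vbar

/-- Derivative at `X ∈ Sp(2k,2n)`, in the tangent direction `Z`, of a map of class `C^1` on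
`Sp(2k,2n)`. All derivatives of the map within `Sp(2k,2n)` agree on tangent vectors, so for
`Z ∈ TSp X` this is `D Vbar (X)[Z]` for every differentiable local extension `Vbar`. -/
def tder {k n : ℕ} {F : Type} [NormedAddCommGroup F] [NormedSpace ℝ F]
    (V : Amb k n → F) (X Z : Amb k n) : F :=
  fderivWithin ℝ V (Sp k n) X Z

/-- A tangent vector field of class `C^1` on `Sp(2k,2n)`. -/
def IsC1Field {k n : ℕ} (V : Amb k n → Amb k n) : Prop :=
  IsCr 1 V ∧ ∀ X ∈ Sp k n, V X ∈ TSp X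

/-- The Riemannian (Levi-Civita) connection of the metric `g` on `Sp(2k,2n)`; `con X Z V` is the
covariant derivative at `X` of the field `V` in the tangent direction `Z`. It is a connection
that is torsion-free and compatible with the metric. -/
structure IsRiemannianConnection {k n : ℕ} (g : Amb k n → Amb k n → Amb k n → ℝ)
    (con : Amb k n → Amb k n → (Amb k n → Amb k n) → Amb k n) : Prop where
  tangent : ∀ X ∈ Sp k n, ∀ Z ∈ TSp X, ∀ V, IsC1Field V → con X Z V ∈ TSp X
  linear_dir : ∀ X ∈ Sp k n, ∀ Z ∈ TSp X, ∀ Z' ∈ TSp X, ∀ a b : ℝ, ∀ V, IsC1Field V →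
    con X (a • Z + b • Z') V = a • con X Z V + b • con X Z' V
  add_field : ∀ X ∈ Sp k n, ∀ Z ∈ TSp X, ∀ V W, IsC1Field V → IsC1Field W →
    con X Z (fun Y => V Y + W Y) = con X Z V + con X Z W
  leibniz : ∀ X ∈ Sp k n, ∀ Z ∈ TSp X, ∀ φ : Amb k n → ℝ, IsCr 1 φ → ∀ V, IsC1Field V →
    con X Z (fun Y => φ Y • V Y) = φ X • con X Z V + tder φ X Z • V X
  torsion_free : ∀ X ∈ Sp k n, ∀ V W, IsC1Field V → IsC1Field W →
    con X (V X) W - con X (W X) V = tder W X (V X) - tder V X (W X)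
  metric : ∀ X ∈ Sp k n, ∀ Z ∈ TSp X, ∀ V W, IsC1Field V → IsC1Field W →
    tder (fun Y => g Y (V Y) (W Y)) X Z = g X (con X Z V) (W X) + g X (V X) (con X Z W)

/-- The Riemannian connection of the metric `g`. -/
def riemannianConnection {k n : ℕ} (g : Amb k n → Amb k n → Amb k n → ℝ) :
    Amb k n → Amb k n → (Amb k n → Amb k n) → Amb k n :=
  Classical.epsilon (IsRiemannianConnection g)

/-- `G` is the Riemannian gradient of `f` at `X`. -/
def IsRiemannianGradientAt {k n : ℕ} (g : Amb k n → Amb k n → Amb k n → ℝ)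
    (f : Amb k n → ℝ) (X G : Amb k n) : Prop :=
  G ∈ TSp X ∧ ∀ Z ∈ TSp X, g X G Z = tder f X Z

/-- The Riemannian gradient field of `f` with respect to the metric `g`. -/
def riemannianGradient {k n : ℕ} (g : Amb k n → Amb k n → Amb k n → ℝ)
    (f : Amb k n → ℝ) (X : Amb k n) : Amb k n :=
  Classical.epsilon (IsRiemannianGradientAt g f X)

/-- The Riemannian Hessian `Hess f (X)[Z] = ∇_Z grad f (X)`. -/
def riemannianHessian {k n : ℕ} (g : Amb k n → Amb k n → Amb k n → ℝ)
    (f : Amb k n → ℝ) (X Z : Amb k n) : Amb k n :=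
  riemannianConnection g X Z (riemannianGradient g f)

/-- The Euclidean gradient of a function on the ambient space: the matrix of its partial
derivatives. -/
def ambientGradient {k n : ℕ} (fbar : Amb k n → ℝ) (X : Amb k n) : Amb k n :=
  Matrix.of fun i j => fderiv ℝ fbar X (Matrix.single i j 1)

/-- The Euclidean Hessian `∇² fbar (X)[Z]`: the derivative of the Euclidean gradient along `Z`. -/
def ambientHessian {k n : ℕ} (fbar : Amb k n → ℝ) (X Z : Amb k n) : Amb k n :=
  fderiv ℝ (ambientGradient fbar) X Z

/-! ### The canonical-like metric -/

/-- `Xp` is an orthogonal complement `X_⊥` of `X`, of full rank, normalized so that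
`X_⊥ (X_⊥ᵀ J X_⊥)⁻¹` has orthonormal columns. -/
structure IsNormalizedComplement {k n : ℕ} (X : Amb k n)
    (Xp : Matrix (Fin n ⊕ Fin n) (Fin (2 * n - 2 * k)) ℝ) : Prop where
  orthogonal : Xᵀ * Xp = 0
  full_rank : Xp.rank = 2 * n - 2 * k
  normalized : (Xp * (Xpᵀ * J n * Xp)⁻¹)ᵀ * (Xp * (Xpᵀ * J n * Xp)⁻¹) = 1

/-- The matrix `M_{X,c,ρ}` defining the canonical-like metric. -/
def metricMatrix {k n : ℕ} (ρ : ℝ) (X : Amb k n)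
    (Xp : Matrix (Fin n ⊕ Fin n) (Fin (2 * n - 2 * k)) ℝ) :
    Matrix (Fin n ⊕ Fin n) (Fin n ⊕ Fin n) ℝ :=
  (1 / ρ) • (J n * X * Xᵀ * (J n)ᵀ) - Xp * ((Xpᵀ * J n * Xp)⁻¹ ^ 2) * Xpᵀ

/-- The canonical-like metric `g_X(Z₁, Z₂) = tr(Z₁ᵀ M_{X,c,ρ} Z₂)`, for a choice
`X ↦ Xperp X` of the complements. -/
def canonicalMetric {k n : ℕ} (ρ : ℝ)
    (Xperp : Amb k n → Matrix (Fin n ⊕ Fin n) (Fin (2 * n - 2 * k)) ℝ)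
    (X Z₁ Z₂ : Amb k n) : ℝ :=
  Matrix.trace (Z₁ᵀ * metricMatrix ρ X (Xperp X) * Z₂)

/-- The projection `P_{X,c}(Y) = Y - X J skew(Xᵀ Jᵀ Y)`. -/
def projC {k n : ℕ} (X Y : Amb k n) : Amb k n :=
  Y - X * J k * skew (Xᵀ * (J n)ᵀ * Y)

/-- The matrix `P_X = I - X J Xᵀ Jᵀ`. -/
def obliqueProj {k n : ℕ} (X : Amb k n) : Matrix (Fin n ⊕ Fin n) (Fin n ⊕ Fin n) ℝ :=
  1 - X * J k * Xᵀ * (J n)ᵀ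

end SymplecticStiefel

end

namespace SymplecticStiefel

lemma J_mul_J (m : ℕ) : J m * J m = -1 := by
  unfold J
  rw [Matrix.fromBlocks_multiply, ← Matrix.fromBlocks_one, Matrix.fromBlocks_neg]
  simp

lemma J_transpose (m : ℕ) : (J m)ᵀ = -J m := by
  unfold J
  rw [Matrix.fromBlocks_transpose, Matrix.fromBlocks_neg]
  simp

lemma IsNormalizedComplement.isUnit_det {k n : ℕ} {X : Amb k n}
    {Xp : Matrix (Fin n ⊕ Fin n) (Fin (2 * n - 2 * k)) ℝ} (h : IsNormalizedComplement X Xp) :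
    IsUnit (Xpᵀ * J n * Xp).det := by
  by_contra hd
  have h1 := h.normalized
  rw [Matrix.nonsing_inv_apply_not_isUnit _ hd] at h1
  rw [Matrix.mul_zero] at h1
  have h2 : IsEmpty (Fin (2 * n - 2 * k)) := by
    rw [← not_nonempty_iff]
    rintro ⟨i⟩
    have := congrFun (congrFun h1 i) i
    simp at this
  exact hd (by simp)

/-- On tangent vectors written as `X J W + J X_⊥ K` with `W` symmetric, the canonical-like metric
is `(1/ρ) tr(W₁ᵀ W₂) + tr(K₁ᵀ K₂)`. -/
theorem canonicalMetric_apply {k n : ℕ} (ρ : ℝ)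
    (Xperp : Amb k n → Matrix (Fin n ⊕ Fin n) (Fin (2 * n - 2 * k)) ℝ) (X : Amb k n)
    (hX : X ∈ Sp k n) (h : IsNormalizedComplement X (Xperp X))
    (W₁ W₂ : Matrix (Fin k ⊕ Fin k) (Fin k ⊕ Fin k) ℝ)
    (K₁ K₂ : Matrix (Fin (2 * n - 2 * k)) (Fin k ⊕ Fin k) ℝ) :
    canonicalMetric ρ Xperp X (X * J k * W₁ + J n * Xperp X * K₁)
        (X * J k * W₂ + J n * Xperp X * K₂) =
      (1 / ρ) * Matrix.trace (W₁ᵀ * W₂) + Matrix.trace (K₁ᵀ * K₂) := by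
  have hd := h.isUnit_det
  have ho := h.orthogonal
  unfold canonicalMetric metricMatrix
  set Q := Xperp X with hQ
  have hX' : Xᵀ * J n * X = J k := hX
  have ho' : Qᵀ * X = 0 := by
    have := congrArg Matrix.transpose ho
    simpa using this
  set A := Qᵀ * J n * Q with hA
  have a1 : ∀ (W : Matrix (Fin k ⊕ Fin k) (Fin k ⊕ Fin k) ℝ)
      (K : Matrix (Fin (2 * n - 2 * k)) (Fin k ⊕ Fin k) ℝ),
      Xᵀ * (J n)ᵀ * (X * J k * W + J n * Q * K) = W := by
    intro W K
    have e1 : Xᵀ * (J n)ᵀ * (X * J k * W) = -((Xᵀ * J n * X) * J k * W) := by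
      simp only [J_transpose, Matrix.mul_assoc, Matrix.neg_mul, Matrix.mul_neg]
    have e2 : Xᵀ * (J n)ᵀ * (J n * Q * K) = -(Xᵀ * (J n * J n) * Q * K) := by
      simp only [J_transpose, Matrix.mul_assoc, Matrix.neg_mul, Matrix.mul_neg]
    rw [Matrix.mul_add, e1, e2, hX', J_mul_J, J_mul_J]
    simp [ho]
  have a2 : ∀ (W : Matrix (Fin k ⊕ Fin k) (Fin k ⊕ Fin k) ℝ)
      (K : Matrix (Fin (2 * n - 2 * k)) (Fin k ⊕ Fin k) ℝ),
      Qᵀ * (X * J k * W + J n * Q * K) = A * K := by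
    intro W K
    have e1 : Qᵀ * (X * J k * W) = (Qᵀ * X) * J k * W := by simp only [Matrix.mul_assoc]
    have e2 : Qᵀ * (J n * Q * K) = A * K := by simp only [hA, Matrix.mul_assoc]
    rw [Matrix.mul_add, e1, e2, ho']
    simp
  have hAt : Aᵀ = -A := by
    simp only [hA, Matrix.transpose_mul, Matrix.transpose_transpose, J_transpose, Matrix.mul_assoc,
      Matrix.neg_mul, Matrix.mul_neg]
  set Z₁ := X * J k * W₁ + J n * Q * K₁
  set Z₂ := X * J k * W₂ + J n * Q * K₂
  have b1 : Z₁ᵀ * (J n * X * Xᵀ * (J n)ᵀ) * Z₂ = W₁ᵀ * W₂ := by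
    have : Z₁ᵀ * (J n * X * Xᵀ * (J n)ᵀ) * Z₂ =
        (Xᵀ * (J n)ᵀ * Z₁)ᵀ * (Xᵀ * (J n)ᵀ * Z₂) := by
      simp only [Matrix.transpose_mul, Matrix.transpose_transpose, Matrix.mul_assoc]
    rw [this, a1, a1]
  have b2 : Z₁ᵀ * (Q * (A⁻¹ ^ 2) * Qᵀ) * Z₂ = -(K₁ᵀ * K₂) := by
    have : Z₁ᵀ * (Q * (A⁻¹ ^ 2) * Qᵀ) * Z₂ = (Qᵀ * Z₁)ᵀ * (A⁻¹ ^ 2) * (Qᵀ * Z₂) := by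
      simp only [Matrix.transpose_mul, Matrix.transpose_transpose, Matrix.mul_assoc]
    rw [this, a2, a2, Matrix.transpose_mul, hAt]
    have e : K₁ᵀ * -A * A⁻¹ ^ 2 * (A * K₂) = -(K₁ᵀ * ((A * A⁻¹) * (A⁻¹ * A)) * K₂) := by
      simp only [pow_two, Matrix.mul_assoc, Matrix.neg_mul, Matrix.mul_neg]
    rw [e, Matrix.mul_nonsing_inv _ hd, Matrix.nonsing_inv_mul _ hd]
    simp
  rw [Matrix.mul_sub, Matrix.sub_mul, b2, Matrix.mul_smul, Matrix.smul_mul, b1]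
  simp [Matrix.trace_smul]

/-- Every `X ∈ Sp(2k,2n)` has a normalized complement. -/
theorem exists_isNormalizedComplement {k n : ℕ} (X : Amb k n) (hX : X ∈ Sp k n) :
    ∃ Xp, IsNormalizedComplement X Xp := by
  have hX' : Xᵀ * J n * X = J k := hX
  let L := Matrix.toEuclideanLin X
  have hL : Function.Injective L := by
    rw [injective_iff_map_eq_zero]
    intro v hv
    have h0 : X *ᵥ v.ofLp = 0 := by
      have := congrArg WithLp.ofLp hv
      simpa [L, Matrix.toLpLin_apply] using this
    have h1 : J k *ᵥ v.ofLp = 0 := by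
      rw [← hX', ← Matrix.mulVec_mulVec, h0, Matrix.mulVec_zero]
    have h2 : (J k * J k) *ᵥ v.ofLp = 0 := by
      rw [← Matrix.mulVec_mulVec, h1, Matrix.mulVec_zero]
    rw [J_mul_J, Matrix.neg_mulVec, Matrix.one_mulVec, neg_eq_zero] at h2
    ext i
    exact congrFun h2 i
  have hfr : Module.finrank ℝ (L.range)ᗮ = 2 * n - 2 * k := by
    have h1 := L.range.finrank_add_finrank_orthogonal
    rw [LinearMap.finrank_range_of_inj hL] at h1
    simp at h1
    omega
  let b := (stdOrthonormalBasis ℝ (L.range)ᗮ).reindex (finCongr hfr)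
  let Q : Matrix (Fin n ⊕ Fin n) (Fin (2 * n - 2 * k)) ℝ :=
    Matrix.of fun i j => (b j : EuclideanSpace ℝ (Fin n ⊕ Fin n)) i
  have hQQ : Qᵀ * Q = 1 := by
    ext i j
    have := b.inner_eq_ite i j
    rw [Submodule.coe_inner, EuclideanSpace.inner_eq_star_dotProduct] at this
    rw [Matrix.mul_apply, Matrix.one_apply, ← this, dotProduct]
    refine Finset.sum_congr rfl fun l _ => ?_
    exact mul_comm _ _
  have hXQ : Xᵀ * Q = 0 := by
    ext i j
    have h1 : L (EuclideanSpace.single i 1) ∈ L.range := ⟨_, rfl⟩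
    have := (Submodule.mem_orthogonal _ _).1 (b j).2 _ h1
    rw [EuclideanSpace.inner_eq_star_dotProduct] at this
    rw [Matrix.mul_apply, Matrix.zero_apply, ← this, dotProduct]
    refine Finset.sum_congr rfl fun l _ => ?_
    simp only [L, Q, Matrix.toLpLin_apply, Matrix.transpose_apply, Matrix.of_apply]
    simp [mul_comm]
  have hrange : ∀ v : Fin n ⊕ Fin n → ℝ, Qᵀ *ᵥ v = 0 → ∃ w, X *ᵥ w = v := by
    intro v hv
    have h1 : (WithLp.toLp 2 v : EuclideanSpace ℝ (Fin n ⊕ Fin n)) ∈ (L.range)ᗮᗮ := by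
      rw [Submodule.mem_orthogonal]
      intro u hu
      have h2 := b.sum_repr ⟨u, hu⟩
      have h3 := congrArg (fun z : (L.range)ᗮ => (z : EuclideanSpace ℝ (Fin n ⊕ Fin n))) h2
      simp only [Submodule.coe_sum, Submodule.coe_smul] at h3
      rw [← h3, sum_inner]
      refine Finset.sum_eq_zero fun j _ => ?_
      rw [inner_smul_left]
      have h4 := congrFun hv j
      have h5 : inner ℝ (b j : EuclideanSpace ℝ (Fin n ⊕ Fin n)) (WithLp.toLp 2 v) = 0 := by
        rw [EuclideanSpace.inner_eq_star_dotProduct]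
        rw [Pi.zero_apply] at h4
        rw [← h4, Matrix.mulVec, dotProduct, dotProduct]
        exact Finset.sum_congr rfl fun l _ => mul_comm _ _
      rw [h5, mul_zero]
    rw [Submodule.orthogonal_orthogonal] at h1
    obtain ⟨w, hw⟩ := h1
    refine ⟨w.ofLp, ?_⟩
    have := congrArg WithLp.ofLp hw
    simpa [L, Matrix.toLpLin_apply] using this
  let S := Qᵀ * J n * Q
  have hSt : Sᵀ = -S := by
    simp only [S, Matrix.transpose_mul, Matrix.transpose_transpose, J_transpose, Matrix.mul_assoc,
      Matrix.neg_mul, Matrix.mul_neg]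
  have hS : IsUnit S.det := by
    rw [← Matrix.isUnit_iff_isUnit_det, ← Matrix.mulVec_injective_iff_isUnit]
    rw [← Matrix.coe_mulVecLin, injective_iff_map_eq_zero]
    intro v hv
    rw [Matrix.mulVecLin_apply] at hv
    have h1 : Qᵀ *ᵥ (J n *ᵥ (Q *ᵥ v)) = 0 := by
      rw [Matrix.mulVec_mulVec, Matrix.mulVec_mulVec]; exact hv
    obtain ⟨w, hw⟩ := hrange _ h1
    have h2 : Q *ᵥ v = -(J n *ᵥ (X *ᵥ w)) := by
      rw [hw, Matrix.mulVec_mulVec, J_mul_J, Matrix.neg_mulVec, Matrix.one_mulVec, neg_neg]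
    have h3 : J k *ᵥ w = 0 := by
      rw [← hX', ← Matrix.mulVec_mulVec, ← Matrix.mulVec_mulVec, ← neg_eq_zero, ← Matrix.mulVec_neg,
        ← h2, Matrix.mulVec_mulVec, hXQ, Matrix.zero_mulVec]
    have h4 : w = 0 := by
      have : (J k * J k) *ᵥ w = 0 := by rw [← Matrix.mulVec_mulVec, h3, Matrix.mulVec_zero]
      rwa [J_mul_J, Matrix.neg_mulVec, Matrix.one_mulVec, neg_eq_zero] at this
    rw [h4, Matrix.mulVec_zero, Matrix.mulVec_zero, neg_zero] at h2
    have : (Qᵀ * Q) *ᵥ v = 0 := by rw [← Matrix.mulVec_mulVec, h2, Matrix.mulVec_zero]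
    rwa [hQQ, Matrix.one_mulVec] at this
  have hSS : S * S⁻¹ = 1 := Matrix.mul_nonsing_inv _ hS
  have hSS' : S⁻¹ * S = 1 := Matrix.nonsing_inv_mul _ hS
  have hSit : (S⁻¹)ᵀ = -S⁻¹ := by
    rw [Matrix.transpose_nonsing_inv, hSt]
    exact Matrix.inv_eq_right_inv (by rw [Matrix.neg_mul, Matrix.mul_neg, neg_neg, hSS])
  have hA : (Q * S⁻¹)ᵀ * J n * (Q * S⁻¹) = -S⁻¹ := by
    have : (Q * S⁻¹)ᵀ * J n * (Q * S⁻¹) = (S⁻¹)ᵀ * (S * S⁻¹) := by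
      simp only [S, Matrix.transpose_mul, Matrix.mul_assoc]
    rw [this, hSS, hSit, mul_one]
  have hB : (-S⁻¹)⁻¹ = -S := Matrix.inv_eq_right_inv (by rw [Matrix.neg_mul, Matrix.mul_neg, neg_neg, hSS'])
  refine ⟨Q * S⁻¹, ⟨by rw [← Matrix.mul_assoc, hXQ, Matrix.zero_mul], ?_, ?_⟩⟩
  · rw [Matrix.rank_mul_eq_left_of_isUnit_det]
    · rw [← Matrix.rank_transpose_mul_self, hQQ, Matrix.rank_one, Fintype.card_fin]
    · exact Matrix.isUnit_nonsing_inv_det _ hS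
  · rw [hA, hB, Matrix.mul_neg, Matrix.mul_assoc, hSS', Matrix.mul_one, Matrix.transpose_neg,
      Matrix.neg_mul, Matrix.mul_neg, neg_neg, hQQ]

end SymplecticStiefel

namespace SymplecticStiefel

/-! ### Algebra of the canonical-like metric -/

/-! On `Sp(2k,2n)` the normalization makes `U = X_⊥(X_⊥ᵀJX_⊥)⁻¹` an orthonormal basis of the
complement of the columns of `X`, and skewness of `X_⊥ᵀJX_⊥` turns the second term of `M_X` into `U
Uᵀ = I - X(XᵀX)⁻¹Xᵀ`. Hence `M_X` depends on `X` alone (`metricMatrix_eq`), however irregular the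
choice of `X_⊥`. It can be differentiated in `X`, and its inverse `ρXXᵀ + P_X P_Xᵀ` is polynomial in
`X`.

Tangency of `Z` means that `XᵀJZ` is symmetric, and the `M_X`-normal vectors are the `XJΩ` with `Ω`
skew; orthogonality is the vanishing of the trace of skew times symmetric. Derivatives along the
manifold are taken on the curves `exp(tA)X` with `A` Hamiltonian, which realize every tangent vector
(`exists_curve`). The connection is the projection by `P_{X,c}` of the Levi-Civita connection of the
ambient field `M`; uniqueness is the usual argument for a tensor symmetric in two slots and skew in
two.

The gradient is `V = P_{X,c}(M⁻¹G)`, with `MV = G - JXΩ` and `Ω = skew(JᵀXᵀG)`. Differentiating this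
relation along a curve gives `DM[Z]V + MV' = H - JZΩ - JXΩ'`. The unknown `JXΩ'` disappears under
`P_{X,c}M⁻¹`, so the Hessian is explicit in `H`, `Ω`, `DM` and its adjoint (`riemannianHessian_eq`).

What remains is algebra: write `Z = XJT + F`, `V = ρXJS + P_X E`, `G = JX(S + Ω) + E` with `T`, `S`
symmetric, and compare the two components of `P_{X,c}Y = XJ sym(XᵀJᵀY) + P_X Y`
(`hessian_symm_part`, `hessian_oblique_part`). -/

lemma J_mul_J_mul {m : ℕ} {ι : Type} (A : Matrix (Fin m ⊕ Fin m) ι ℝ) :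
    J m * (J m * A) = -A := by
  rw [← Matrix.mul_assoc, J_mul_J, Matrix.neg_mul, Matrix.one_mul]

section Relations

variable {k n : ℕ} {X : Amb k n}

lemma transpose_J_self (hX : X ∈ Sp k n) : Xᵀ * (J n * X) = J k := by
  rw [← Matrix.mul_assoc]; exact hX

lemma transpose_J_self_mul (hX : X ∈ Sp k n) {ι : Type} (A : Matrix (Fin k ⊕ Fin k) ι ℝ) :
    Xᵀ * (J n * (X * A)) = J k * A := by
  rw [← transpose_J_self hX]; simp only [Matrix.mul_assoc]

/-- `X` is injective because `XᵀJX = J` is, so its Gram matrix is positive definite. -/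
lemma isUnit_gram (hX : X ∈ Sp k n) : IsUnit (Xᵀ * X).det := by
  have h : (Xᵀ * X).PosDef := by
    rw [← Matrix.conjTranspose_eq_transpose_of_trivial]
    refine Matrix.PosDef.conjTranspose_mul_self _ ?_
    intro v w hvw
    have h1 : ∀ u, J k *ᵥ u = Xᵀ *ᵥ (J n *ᵥ (X *ᵥ u)) := fun u => by
      rw [Matrix.mulVec_mulVec, Matrix.mulVec_mulVec, Matrix.mul_assoc, transpose_J_self hX]
    have h2 : J k *ᵥ v = J k *ᵥ w := by
      rw [h1, h1]; exact congrArg (fun z => Xᵀ *ᵥ (J n *ᵥ z)) hvw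
    have h3 := congrArg (fun z => J k *ᵥ z) h2
    simpa [Matrix.mulVec_mulVec, J_mul_J, Matrix.neg_mulVec] using h3
  exact h.det_pos.ne'.isUnit

lemma gram_mul_inv (hX : X ∈ Sp k n) : Xᵀ * (X * (Xᵀ * X)⁻¹) = 1 := by
  rw [← Matrix.mul_assoc]; exact Matrix.mul_nonsing_inv _ (isUnit_gram hX)

lemma gram_mul_inv_mul (hX : X ∈ Sp k n) {ι : Type} (A : Matrix (Fin k ⊕ Fin k) ι ℝ) :
    Xᵀ * (X * ((Xᵀ * X)⁻¹ * A)) = A := by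
  rw [← Matrix.mul_assoc X, ← Matrix.mul_assoc Xᵀ, gram_mul_inv hX, Matrix.one_mul]

lemma inv_mul_gram (hX : X ∈ Sp k n) : (Xᵀ * X)⁻¹ * (Xᵀ * X) = 1 :=
  Matrix.nonsing_inv_mul _ (isUnit_gram hX)

lemma inv_mul_gram_mul (hX : X ∈ Sp k n) {ι : Type} (A : Matrix (Fin k ⊕ Fin k) ι ℝ) :
    (Xᵀ * X)⁻¹ * (Xᵀ * (X * A)) = A := by
  rw [← Matrix.mul_assoc Xᵀ, ← Matrix.mul_assoc, inv_mul_gram hX, Matrix.one_mul]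

lemma transpose_gram_inv (X : Amb k n) : ((Xᵀ * X)⁻¹)ᵀ = (Xᵀ * X)⁻¹ := by
  rw [Matrix.transpose_nonsing_inv, Matrix.transpose_mul, Matrix.transpose_transpose]

end Relations

/-- The canonical-like metric matrix, as a function of `X` alone. -/
noncomputable def metricField {k n : ℕ} (ρ : ℝ) (X : Amb k n) :
    Matrix (Fin n ⊕ Fin n) (Fin n ⊕ Fin n) ℝ :=
  (1 / ρ) • (J n * X * Xᵀ * (J n)ᵀ) + (1 - X * (Xᵀ * X)⁻¹ * Xᵀ)

/-- On `Sp(2k,2n)`, the inverse of the canonical-like metric matrix. -/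
noncomputable def metricInv {k n : ℕ} (ρ : ℝ) (X : Amb k n) :
    Matrix (Fin n ⊕ Fin n) (Fin n ⊕ Fin n) ℝ :=
  ρ • (X * Xᵀ) + obliqueProj X * (obliqueProj X)ᵀ

/-- `A = QᵀJQ` is skew, hence so is `A⁻¹`, and `-A⁻² = A⁻¹(A⁻¹)ᵀ`. -/
lemma neg_sq_inv_eq {k n : ℕ} (Q : Matrix (Fin n ⊕ Fin n) (Fin (2 * n - 2 * k)) ℝ) :
    -(Q * ((Qᵀ * J n * Q)⁻¹ ^ 2) * Qᵀ) = (Q * (Qᵀ * J n * Q)⁻¹) * (Q * (Qᵀ * J n * Q)⁻¹)ᵀ := by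
  have h1 : ((Qᵀ * J n * Q)⁻¹)ᵀ = -(Qᵀ * J n * Q)⁻¹ := by
    have hAt : (Qᵀ * J n * Q)ᵀ = -(Qᵀ * J n * Q) := by
      simp only [Matrix.transpose_mul, Matrix.transpose_transpose, J_transpose, Matrix.mul_assoc,
        Matrix.neg_mul, Matrix.mul_neg]
    rw [Matrix.transpose_nonsing_inv, hAt, ← neg_one_smul ℝ, ← neg_one_smul ℝ (Qᵀ * J n * Q)⁻¹]
    by_cases hd : IsUnit (Qᵀ * J n * Q).det
    · refine Matrix.inv_eq_right_inv ?_
      simp [Matrix.mul_nonsing_inv _ hd]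
    -- For singular `A` both inverses take the default value `0`, so no invertibility hypothesis is
    -- required.
    · have hd' : ¬ IsUnit ((-1 : ℝ) • (Qᵀ * J n * Q)).det := by
        rw [Matrix.det_smul]; simpa [isUnit_iff_ne_zero] using hd
      rw [Matrix.nonsing_inv_apply_not_isUnit _ hd, Matrix.nonsing_inv_apply_not_isUnit _ hd',
        smul_zero]
  rw [Matrix.transpose_mul, h1, pow_two]
  simp only [Matrix.mul_assoc, Matrix.neg_mul, Matrix.mul_neg]

/-- The block matrix `[X | U]` has the left inverse with row blocks `(XᵀX)⁻¹Xᵀ` and `Uᵀ`. It is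
square, so this is also a right inverse. -/
lemma IsNormalizedComplement.resolution {k n : ℕ} (hkn : k ≤ n) {X : Amb k n} (hX : X ∈ Sp k n)
    {Q : Matrix (Fin n ⊕ Fin n) (Fin (2 * n - 2 * k)) ℝ} (h : IsNormalizedComplement X Q) :
    (Q * (Qᵀ * J n * Q)⁻¹) * (Q * (Qᵀ * J n * Q)⁻¹)ᵀ = 1 - X * (Xᵀ * X)⁻¹ * Xᵀ := by
  have h2 := h.normalized
  have h3 : Xᵀ * (Q * (Qᵀ * J n * Q)⁻¹) = 0 := by
    rw [← Matrix.mul_assoc, h.orthogonal, Matrix.zero_mul]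
  set U := Q * (Qᵀ * J n * Q)⁻¹
  have h4 : Uᵀ * X = 0 := by
    simpa using congrArg Matrix.transpose h3
  rw [eq_sub_iff_add_eq, add_comm, Matrix.mul_assoc, ← Matrix.fromCols_mul_fromRows]
  -- The column count `2k + (2n - 2k)` equals `2n` because `k ≤ n`, so the truncated subtraction is
  -- exact.
  have e : (Fin n ⊕ Fin n) ≃ ((Fin k ⊕ Fin k) ⊕ Fin (2 * n - 2 * k)) :=
    Fintype.equivOfCardEq (by simp; omega)
  rw [Matrix.fromCols_mul_fromRows_eq_one_comm e, Matrix.fromRows_mul_fromCols,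
    ← Matrix.fromBlocks_one]
  congr 1
  · rw [Matrix.mul_assoc]; exact inv_mul_gram hX
  · rw [Matrix.mul_assoc, h3, Matrix.mul_zero]

/-- This removes the arbitrary, possibly discontinuous, choice of complement, so that the metric can
be differentiated. -/
lemma metricMatrix_eq {k n : ℕ} (hkn : k ≤ n) (ρ : ℝ) {X : Amb k n} (hX : X ∈ Sp k n)
    {Q : Matrix (Fin n ⊕ Fin n) (Fin (2 * n - 2 * k)) ℝ} (h : IsNormalizedComplement X Q) :
    metricMatrix ρ X Q = metricField ρ X := by
  unfold metricMatrix metricField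
  rw [sub_eq_add_neg, neg_sq_inv_eq, h.resolution hkn hX]

/-! ### Inverse and positivity of the metric; the two projections. -/

section

variable {k n : ℕ} {X : Amb k n} {ρ : ℝ}

lemma metricField_transpose (ρ : ℝ) (X : Amb k n) : (metricField ρ X)ᵀ = metricField ρ X := by
  simp only [metricField, Matrix.transpose_add, Matrix.transpose_sub, Matrix.transpose_smul,
    Matrix.transpose_mul, Matrix.transpose_transpose, Matrix.transpose_one, transpose_gram_inv,
    Matrix.mul_assoc]

/-- Since `XᵀJP_X = 0`, `P_X X = 0` and the residual projector kills `X`, the surviving terms are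
`-JXJXᵀ` and `P_Xᵀ = I + JXJXᵀ`. -/
lemma metricField_mul_metricInv (hρ : 0 < ρ) (hX : X ∈ Sp k n) :
    metricField ρ X * metricInv ρ X = 1 := by
  simp only [metricField, metricInv, obliqueProj, Matrix.transpose_sub, Matrix.transpose_neg,
    Matrix.transpose_mul, Matrix.transpose_transpose, Matrix.transpose_one,
    J_transpose, Matrix.mul_add, Matrix.add_mul, Matrix.mul_sub, Matrix.sub_mul, Matrix.mul_neg,
    Matrix.neg_mul, Matrix.mul_assoc, J_mul_J_mul,
    transpose_J_self_mul hX,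
    inv_mul_gram_mul hX, Matrix.mul_one, Matrix.one_mul, Matrix.mul_smul, Matrix.smul_mul]
  match_scalars <;> field_simp <;> ring

lemma metricField_inv (hρ : 0 < ρ) (hX : X ∈ Sp k n) : (metricField ρ X)⁻¹ = metricInv ρ X :=
  Matrix.inv_eq_right_inv (metricField_mul_metricInv hρ hX)

lemma metricMatrix_posDef (hkn : k ≤ n) (hρ : 0 < ρ) (hX : X ∈ Sp k n)
    {Q : Matrix (Fin n ⊕ Fin n) (Fin (2 * n - 2 * k)) ℝ} (h : IsNormalizedComplement X Q) :
    (metricMatrix ρ X Q).PosDef := by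
  have h1 : (metricMatrix ρ X Q).PosSemidef := by
    unfold metricMatrix
    rw [sub_eq_add_neg, neg_sq_inv_eq]
    refine Matrix.PosSemidef.add (Matrix.PosSemidef.smul ?_ (by positivity)) ?_
    · have := Matrix.posSemidef_self_mul_conjTranspose (J n * X)
      simpa [Matrix.mul_assoc, Matrix.conjTranspose_eq_transpose_of_trivial] using this
    · have := Matrix.posSemidef_self_mul_conjTranspose (Q * (Qᵀ * J n * Q)⁻¹)
      rwa [Matrix.conjTranspose_eq_transpose_of_trivial] at this
  -- Both summands are Gram matrices; definiteness then reduces to invertibility, already exhibited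
  -- by the explicit inverse.
  refine (h1.posDef_iff_isUnit).2 ?_
  rw [metricMatrix_eq hkn ρ hX h]
  exact IsUnit.of_mul_eq_one _ (metricField_mul_metricInv hρ hX)

lemma obliqueProj_sq (hX : X ∈ Sp k n) : obliqueProj X * obliqueProj X = obliqueProj X := by
  simp only [obliqueProj, J_transpose, Matrix.mul_sub, Matrix.sub_mul, Matrix.mul_neg,
    Matrix.neg_mul, Matrix.mul_assoc, J_mul_J_mul, transpose_J_self_mul hX, Matrix.mul_one,
    Matrix.one_mul]
  abel

lemma transpose_J_obliqueProj_mul (hX : X ∈ Sp k n) {ι : Type} (Y : Matrix (Fin n ⊕ Fin n) ι ℝ) :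
    Xᵀ * (J n * (obliqueProj X * Y)) = 0 := by
  simp only [obliqueProj, J_transpose, Matrix.mul_sub, Matrix.sub_mul, Matrix.mul_neg,
    Matrix.neg_mul, Matrix.mul_assoc, J_mul_J_mul, transpose_J_self_mul hX,
    Matrix.one_mul]
  abel

lemma obliqueProj_mul_self (hX : X ∈ Sp k n) : obliqueProj X * X = 0 := by
  simp only [obliqueProj, J_transpose, Matrix.sub_mul, Matrix.mul_neg, Matrix.neg_mul,
    Matrix.one_mul, Matrix.mul_assoc, transpose_J_self hX, J_mul_J, Matrix.mul_one]
  abel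

lemma obliqueProj_mul_metricInv (hX : X ∈ Sp k n) :
    obliqueProj X * metricInv ρ X = obliqueProj X * (obliqueProj X)ᵀ := by
  simp only [metricInv, Matrix.mul_add, Matrix.mul_smul, ← Matrix.mul_assoc,
    obliqueProj_mul_self hX, Matrix.zero_mul, smul_zero, zero_add, obliqueProj_sq hX]

lemma transpose_J_metricInv (hX : X ∈ Sp k n) :
    Xᵀ * (J n)ᵀ * metricInv ρ X = ρ • ((J k)ᵀ * Xᵀ) := by
  simp only [metricInv, Matrix.mul_add, J_transpose, Matrix.mul_neg, Matrix.neg_mul,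
    Matrix.mul_assoc, transpose_J_obliqueProj_mul hX, Matrix.mul_smul, transpose_J_self_mul hX]
  module

lemma mem_TSp_iff {Z : Amb k n} : Z ∈ TSp X ↔ (Xᵀ * (J n * Z))ᵀ = Xᵀ * (J n * Z) := by
  simp only [TSp, Set.mem_ofPred_eq, Matrix.transpose_mul, Matrix.transpose_transpose, J_transpose,
    Matrix.mul_neg, Matrix.neg_mul, Matrix.mul_assoc]
  rw [add_eq_zero_iff_eq_neg, eq_comm]

lemma obliqueProj_mul_mem (hX : X ∈ Sp k n) (Y : Amb k n) : obliqueProj X * Y ∈ TSp X := by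
  rw [mem_TSp_iff, transpose_J_obliqueProj_mul hX, Matrix.transpose_zero]

lemma skew_transpose {ι : Type} (A : Matrix ι ι ℝ) : (skew A)ᵀ = -skew A := by
  simp only [skew, Matrix.transpose_smul, Matrix.transpose_sub, Matrix.transpose_transpose]
  module

lemma symm_transpose {ι : Type} (A : Matrix ι ι ℝ) : (symm A)ᵀ = symm A := by
  simp only [symm, Matrix.transpose_smul, Matrix.transpose_add, Matrix.transpose_transpose]
  module

lemma projC_mem (hX : X ∈ Sp k n) (Y : Amb k n) : projC X Y ∈ TSp X := by
  rw [mem_TSp_iff]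
  simp only [projC, skew, J_transpose, Matrix.mul_sub, Matrix.mul_smul, Matrix.mul_assoc,
    transpose_J_self_mul hX, J_mul_J_mul, Matrix.transpose_sub, Matrix.transpose_smul,
    Matrix.transpose_neg, Matrix.transpose_transpose, Matrix.mul_neg, Matrix.neg_mul]
  module

lemma projC_of_mem {Z : Amb k n} (hZ : Z ∈ TSp X) : projC X Z = Z := by
  have h := mem_TSp_iff.1 hZ
  have h1 : skew (Xᵀ * (J n)ᵀ * Z) = 0 := by
    rw [skew, J_transpose, Matrix.mul_neg, Matrix.neg_mul, Matrix.mul_assoc, Matrix.transpose_neg,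
      h, sub_self, smul_zero]
  rw [projC, h1, Matrix.mul_zero, sub_zero]

lemma projC_add (X Y Y' : Amb k n) : projC X (Y + Y') = projC X Y + projC X Y' := by
  simp only [projC, skew, Matrix.mul_add, Matrix.transpose_add, Matrix.mul_smul, Matrix.mul_sub]
  module

lemma projC_smul (X : Amb k n) (a : ℝ) (Y : Amb k n) : projC X (a • Y) = a • projC X Y := by
  simp only [projC, skew, Matrix.transpose_smul, Matrix.mul_smul, Matrix.mul_sub]
  module

lemma projC_sub (X Y Y' : Amb k n) : projC X (Y - Y') = projC X Y - projC X Y' := by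
  rw [sub_eq_add_neg, projC_add, ← neg_one_smul ℝ Y', projC_smul]; module

lemma trace_skew_mul_symm {ι : Type} [Fintype ι] {A B : Matrix ι ι ℝ} (hA : Aᵀ = -A)
    (hB : Bᵀ = B) : Matrix.trace (A * B) = 0 := by
  have h := Matrix.trace_transpose (A * B)
  rw [Matrix.transpose_mul, hA, hB, Matrix.mul_neg, Matrix.trace_neg, Matrix.trace_mul_comm] at h
  linarith

/-- The correction `Y - P_{X,c}(Y)` is orthogonal to the tangent space. -/
lemma trace_normal (hX : X ∈ Sp k n) (Y : Amb k n) {V : Amb k n} (hV : V ∈ TSp X) :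
    Matrix.trace ((Y - projC X Y)ᵀ * metricField ρ X * V) = 0 := by
  have h1 : (Y - projC X Y)ᵀ * metricField ρ X * V =
      ((1 / ρ) • (skew (Xᵀ * (J n)ᵀ * Y) * (Xᵀ * (J n * V)))) := by
    simp only [projC, sub_sub_cancel, Matrix.transpose_mul, skew_transpose, metricField,
      J_transpose, Matrix.mul_add, Matrix.add_mul, Matrix.mul_sub, Matrix.sub_mul, Matrix.mul_neg,
      Matrix.neg_mul, Matrix.mul_assoc, J_mul_J_mul, transpose_J_self_mul hX, gram_mul_inv_mul hX,
      Matrix.mul_one, Matrix.mul_smul, Matrix.smul_mul, neg_neg]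
    module
  rw [h1, Matrix.trace_smul,
    trace_skew_mul_symm (skew_transpose _) (mem_TSp_iff.1 hV), smul_zero]

end

/-! ### The algebraic identity behind the Hessian formula -/

/-- The derivative of `metricField` at `X` in the direction `Z`. -/
noncomputable def metricDeriv {k n : ℕ} (ρ : ℝ) (X Z : Amb k n) :
    Matrix (Fin n ⊕ Fin n) (Fin n ⊕ Fin n) ℝ :=
  (1 / ρ) • (J n * (Z * Xᵀ + X * Zᵀ) * (J n)ᵀ) -
    ((1 - X * (Xᵀ * X)⁻¹ * Xᵀ) * Z * (Xᵀ * X)⁻¹ * Xᵀ +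
      X * (Xᵀ * X)⁻¹ * Zᵀ * (1 - X * (Xᵀ * X)⁻¹ * Xᵀ))

/-- The matrix representing `W ↦ tr(Zᵀ (D M (X)[W]) V)`. -/
noncomputable def metricDual {k n : ℕ} (ρ : ℝ) (X Z V : Amb k n) : Amb k n :=
  (1 / ρ) • ((J n)ᵀ * Z * Vᵀ * J n * X + (J n)ᵀ * V * Zᵀ * J n * X) -
    ((1 - X * (Xᵀ * X)⁻¹ * Xᵀ) * Z * Vᵀ * X * (Xᵀ * X)⁻¹ +
      (1 - X * (Xᵀ * X)⁻¹ * Xᵀ) * V * Zᵀ * X * (Xᵀ * X)⁻¹)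

variable {k n : ℕ} {X : Amb k n} {ρ : ℝ}

/-- Splits `P_{X,c}` into the component along `XJ` times symmetric matrices and the component in the
range of `P_X`; the Hessian formula is checked on each. -/
lemma projC_eq (X Y : Amb k n) :
    projC X Y = X * J k * symm (Xᵀ * (J n)ᵀ * Y) + obliqueProj X * Y := by
  simp only [projC, symm, skew, obliqueProj, Matrix.sub_mul, Matrix.mul_smul, Matrix.mul_add,
    Matrix.mul_sub, Matrix.one_mul, Matrix.mul_assoc]
  module

lemma obliqueProj_mul (X Y : Amb k n) :
    obliqueProj X * Y = Y + X * (J k * (Xᵀ * (J n * Y))) := by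
  simp only [obliqueProj, J_transpose, Matrix.mul_neg,
    Matrix.one_mul, Matrix.mul_assoc, sub_neg_eq_add, Matrix.add_mul]

lemma zero_mul_of_mul {a b c d : Type} [Fintype a] [Fintype b] [Fintype c]
    {A : Matrix d b ℝ} {B : Matrix b c ℝ} (h : A * B = 0) (Y : Matrix c a ℝ) :
    A * (B * Y) = 0 := by
  rw [← Matrix.mul_assoc, h, Matrix.zero_mul]

lemma zero_mul_of_mul_mul {a b c d e : Type} [Fintype a] [Fintype b] [Fintype c] [Fintype e]
    {A : Matrix d b ℝ} {C : Matrix b e ℝ} {B : Matrix e c ℝ} (h : A * (C * B) = 0)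
    (Y : Matrix c a ℝ) : A * (C * (B * Y)) = 0 := by
  rw [← Matrix.mul_assoc C, ← Matrix.mul_assoc, h, Matrix.zero_mul]

section

variable {T S Ω : Matrix (Fin k ⊕ Fin k) (Fin k ⊕ Fin k) ℝ} {F E : Amb k n}

/-- `T, F` are the coordinates of the direction, `S, Ω, E` those of the Euclidean gradient, and `V`
is the Riemannian gradient in the same coordinates. With `XᵀJ_n^T M⁻¹ = ρJ_k^T Xᵀ` and the relations
`XᵀJX = J`, `XᵀJF = 0`, `XᵀE = 0`, both sides become combinations of reduced matrix words with equal
coefficients. The second bracket of the formula is absent here because `XᵀJP_X = 0`. -/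
theorem hessian_symm_part (hρ : 0 < ρ) (hX : X ∈ Sp k n) (hT : Tᵀ = T) (hS : Sᵀ = S)
    (hΩ : Ωᵀ = -Ω) (hF : Xᵀ * (J n * F) = 0) (hF' : Fᵀ * (J n * X) = 0) (hE : Xᵀ * E = 0)
    (hE' : Eᵀ * X = 0) (Z V G : Amb k n) (hZ : Z = X * J k * T + F)
    (hV : V = ρ • (X * J k * S) + obliqueProj X * E) (hG : G = J n * X * (S + Ω) + E) :
    symm (Xᵀ * (J n)ᵀ * (metricInv ρ X * (-(J n * Z * Ω) - (1 / 2 : ℝ) • (metricDeriv ρ X Z * V)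
        + (1 / 2 : ℝ) • (metricDeriv ρ X V * Z) - (1 / 2 : ℝ) • metricDual ρ X Z V))) =
      symm (Xᵀ * (J n)ᵀ * (-(ρ • (Z * J k * Ω))
              + (2 : ℝ) • (symm (ρ • (X * Zᵀ)
                  - (2 : ℝ) • (skew (X * J k * Zᵀ) * (J n)ᵀ * (obliqueProj X)ᵀ)) * G)
              + ρ • (X * symm (Xᵀ * J n * Z * Gᵀ * X * J k - Zᵀ * G)))) := by
  rw [← Matrix.mul_assoc _ (metricInv ρ X), transpose_J_metricInv hX, J_transpose k]
  rw [obliqueProj_mul] at hV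
  subst hG hV hZ
  simp only [symm, skew, metricDeriv, metricDual, obliqueProj, J_transpose,
    Matrix.transpose_add, Matrix.transpose_sub, Matrix.transpose_neg, Matrix.transpose_smul,
    Matrix.transpose_mul, Matrix.transpose_transpose, Matrix.transpose_one, transpose_gram_inv,
    hT, hS, hΩ,
    Matrix.mul_add, Matrix.add_mul, Matrix.mul_sub, Matrix.sub_mul, Matrix.mul_neg,
    Matrix.neg_mul, Matrix.mul_smul, Matrix.smul_mul, Matrix.mul_one, Matrix.one_mul,
    Matrix.mul_assoc, J_mul_J_mul, J_mul_J, transpose_J_self hX,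
    transpose_J_self_mul hX, gram_mul_inv hX, gram_mul_inv_mul hX,
    inv_mul_gram_mul hX, hF, hF', hE, hE', zero_mul_of_mul_mul hF, zero_mul_of_mul_mul hF',
    zero_mul_of_mul hE, zero_mul_of_mul hE', Matrix.mul_zero, smul_zero,
    neg_zero, add_zero, zero_add, sub_zero, zero_sub]
  match_scalars <;> field_simp <;> ring

/-- Here `P_X M⁻¹ = P_X P_Xᵀ`, and `P_X X = 0` discards every word starting with `X`. -/
theorem hessian_oblique_part (hρ : 0 < ρ) (hX : X ∈ Sp k n) (hT : Tᵀ = T) (hS : Sᵀ = S)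
    (hΩ : Ωᵀ = -Ω) (hF : Xᵀ * (J n * F) = 0) (hF' : Fᵀ * (J n * X) = 0) (hE : Xᵀ * E = 0)
    (hE' : Eᵀ * X = 0) (Z V G : Amb k n) (hZ : Z = X * J k * T + F)
    (hV : V = ρ • (X * J k * S) + obliqueProj X * E) (hG : G = J n * X * (S + Ω) + E) :
    obliqueProj X * (metricInv ρ X * (-(J n * Z * Ω) - (1 / 2 : ℝ) • (metricDeriv ρ X Z * V)
        + (1 / 2 : ℝ) • (metricDeriv ρ X V * Z) - (1 / 2 : ℝ) • metricDual ρ X Z V)) =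
      obliqueProj X * (-(ρ • (Z * J k * Ω))
              + (2 : ℝ) • (symm (ρ • (X * Zᵀ)
                  - (2 : ℝ) • (skew (X * J k * Zᵀ) * (J n)ᵀ * (obliqueProj X)ᵀ)) * G)
              + ρ • (X * symm (Xᵀ * J n * Z * Gᵀ * X * J k - Zᵀ * G)))
      + obliqueProj X * ((obliqueProj X)ᵀ * J n * (Z * S + (1 / ρ) • (E * Zᵀ * J n * X))
              - J n * X * J k * symm (Zᵀ * E)
              - Z * skew (J k * Xᵀ * J n * E + ρ • (J k * S))
              - E * skew ((Xᵀ * X)⁻¹ * Xᵀ * Z)) := by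
  have hPX := obliqueProj_mul_self hX
  have hPX' : ∀ A : Matrix (Fin k ⊕ Fin k) (Fin k ⊕ Fin k) ℝ, obliqueProj X * (X * A) = 0 :=
    fun A => zero_mul_of_mul hPX A
  rw [← Matrix.mul_assoc _ (metricInv ρ X), obliqueProj_mul_metricInv hX, Matrix.mul_assoc,
    ← Matrix.mul_add]
  have hPt : (obliqueProj X)ᵀ = 1 + J n * (X * (J k * Xᵀ)) := by
    simp only [obliqueProj, J_transpose, Matrix.transpose_sub, Matrix.transpose_mul,
      Matrix.transpose_neg, Matrix.transpose_transpose, Matrix.transpose_one, Matrix.neg_mul,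
      Matrix.mul_neg, neg_neg, Matrix.mul_assoc]
    abel
  rw [obliqueProj_mul] at hV
  subst hG hV hZ
  rw [hPt]
  -- Once the inner projections are expanded, the common left factor matters only through `P X = 0`;
  -- keeping it opaque shortens the words.
  generalize obliqueProj X = P at hPX hPX'
  simp only [symm, skew, metricDeriv, metricDual, J_transpose,
    Matrix.transpose_add, Matrix.transpose_sub, Matrix.transpose_neg, Matrix.transpose_smul,
    Matrix.transpose_mul, Matrix.transpose_transpose, transpose_gram_inv,
    hT, hS, hΩ,
    Matrix.mul_add, Matrix.add_mul, Matrix.mul_sub, Matrix.sub_mul, Matrix.mul_neg,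
    Matrix.neg_mul, Matrix.mul_smul, Matrix.smul_mul, Matrix.mul_one, Matrix.one_mul,
    Matrix.mul_assoc, J_mul_J_mul, J_mul_J, transpose_J_self hX,
    transpose_J_self_mul hX, gram_mul_inv hX, gram_mul_inv_mul hX,
    inv_mul_gram_mul hX, hF, hF', hE, hE', zero_mul_of_mul_mul hF, zero_mul_of_mul_mul hF',
    zero_mul_of_mul hE, zero_mul_of_mul hE', Matrix.mul_zero, smul_zero,
    neg_zero, add_zero, zero_add, sub_zero, zero_sub, hPX']
  match_scalars <;> field_simp <;> ring

end

end SymplecticStiefel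

/-! ### Calculus for matrix-valued maps -/

namespace Matrix

/-- Matrix multiplication as a continuous bilinear map. -/
noncomputable def mulCLM (a b c : Type) [Fintype a] [Fintype b] [Fintype c] :
    Matrix a b ℝ →L[ℝ] Matrix b c ℝ →L[ℝ] Matrix a c ℝ :=
  (LinearMap.mk₂ ℝ (fun (A : Matrix a b ℝ) (B : Matrix b c ℝ) => A * B)
    (fun _ _ _ => Matrix.add_mul _ _ _) (fun _ _ _ => Matrix.smul_mul _ _ _)
    (fun _ _ _ => Matrix.mul_add _ _ _) (fun _ _ _ => Matrix.mul_smul _ _ _)).toContinuousBilinearMap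

/-- Transposition as a continuous linear map. -/
noncomputable def transposeCLM (a b : Type) [Fintype a] [Fintype b] :
    Matrix a b ℝ →L[ℝ] Matrix b a ℝ :=
  LinearMap.toContinuousLinearMap (Matrix.transposeLinearEquiv a b ℝ ℝ).toLinearMap

/-- The trace as a continuous linear map. -/
noncomputable def traceCLM (a : Type) [Fintype a] : Matrix a a ℝ →L[ℝ] ℝ :=
  LinearMap.toContinuousLinearMap (Matrix.traceLinearMap a ℝ ℝ)

end Matrix

section OneVariable

variable {a b c : Type} [Fintype a] [Fintype b] [Fintype c]

lemma HasDerivAt.matrix_mul {A : ℝ → Matrix a b ℝ} {B : ℝ → Matrix b c ℝ} {A' : Matrix a b ℝ}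
    {B' : Matrix b c ℝ} {t : ℝ} (hA : HasDerivAt A A' t) (hB : HasDerivAt B B' t) :
    HasDerivAt (fun s => A s * B s) (A' * B t + A t * B') t := by
  have := (Matrix.mulCLM a b c).hasDerivAt_of_bilinear (fun _ => hA) (fun _ => hB)
  rw [add_comm]; exact this

lemma HasDerivAt.matrix_transpose {A : ℝ → Matrix a b ℝ} {A' : Matrix a b ℝ} {t : ℝ}
    (hA : HasDerivAt A A' t) : HasDerivAt (fun s => (A s)ᵀ) A'ᵀ t :=
  (Matrix.transposeCLM a b).hasFDerivAt.comp_hasDerivAt t hA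

lemma HasDerivAt.matrix_trace {A : ℝ → Matrix a a ℝ} {A' : Matrix a a ℝ} {t : ℝ}
    (hA : HasDerivAt A A' t) : HasDerivAt (fun s => (A s).trace) A'.trace t :=
  (Matrix.traceCLM a).hasFDerivAt.comp_hasDerivAt t hA

end OneVariable

section SeveralVariables

variable {a b c : Type} [Fintype a] [Fintype b] [Fintype c]
  {E : Type} [NormedAddCommGroup E] [NormedSpace ℝ E] {s : Set E} {x : E}

lemma ContDiffAt.matrix_mul {r : WithTop ℕ∞} {A : E → Matrix a b ℝ} {B : E → Matrix b c ℝ}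
    (hA : ContDiffAt ℝ r A x) (hB : ContDiffAt ℝ r B x) :
    ContDiffAt ℝ r (fun y => A y * B y) x :=
  (Matrix.mulCLM a b c).isBoundedBilinearMap.contDiff.contDiffAt.comp x (hA.prodMk hB)

lemma ContDiffAt.matrix_transpose {r : WithTop ℕ∞} {A : E → Matrix a b ℝ}
    (hA : ContDiffAt ℝ r A x) : ContDiffAt ℝ r (fun y => (A y)ᵀ) x :=
  (Matrix.transposeCLM a b).contDiff.contDiffAt.comp x hA

lemma DifferentiableWithinAt.matrix_mul {A : E → Matrix a b ℝ} {B : E → Matrix b c ℝ}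
    (hA : DifferentiableWithinAt ℝ A s x) (hB : DifferentiableWithinAt ℝ B s x) :
    DifferentiableWithinAt ℝ (fun y => A y * B y) s x :=
  ((Matrix.mulCLM a b c).hasFDerivWithinAt_of_bilinear hA.hasFDerivWithinAt
    hB.hasFDerivWithinAt).differentiableWithinAt

lemma DifferentiableWithinAt.matrix_transpose {A : E → Matrix a b ℝ}
    (hA : DifferentiableWithinAt ℝ A s x) : DifferentiableWithinAt ℝ (fun y => (A y)ᵀ) s x :=
  (Matrix.transposeCLM a b).differentiableAt.comp_differentiableWithinAt x hA

lemma DifferentiableWithinAt.matrix_trace {A : E → Matrix a a ℝ}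
    (hA : DifferentiableWithinAt ℝ A s x) : DifferentiableWithinAt ℝ (fun y => (A y).trace) s x :=
  (Matrix.traceCLM a).differentiableAt.comp_differentiableWithinAt x hA

end SeveralVariables

/-! ### Matrix inverse and exponential in the Frobenius Banach algebra. -/

section NormedRing

attribute [local instance] Matrix.frobeniusNormedRing Matrix.frobeniusNormedAlgebra

variable {a : Type} [Fintype a] [DecidableEq a]

lemma Matrix.hasFDerivAt_inv {A : Matrix a a ℝ} (hA : IsUnit A.det) :
    HasFDerivAt (fun B : Matrix a a ℝ => B⁻¹)
      (-ContinuousLinearMap.mulLeftRight ℝ (Matrix a a ℝ) A⁻¹ A⁻¹) A := by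
  obtain ⟨u, rfl⟩ := (Matrix.isUnit_iff_isUnit_det A).2 hA
  have h := hasFDerivAt_ringInverse (𝕜 := ℝ) u
  rw [← Ring.inverse_unit, ← Matrix.nonsing_inv_eq_ringInverse] at h
  refine h.congr_of_eventuallyEq (Filter.Eventually.of_forall fun B => ?_)
  exact Matrix.nonsing_inv_eq_ringInverse B

lemma HasDerivAt.matrix_inv {A : ℝ → Matrix a a ℝ} {A' : Matrix a a ℝ} {t : ℝ}
    (hA : HasDerivAt A A' t) (ht : IsUnit (A t).det) :
    HasDerivAt (fun s => (A s)⁻¹) (-((A t)⁻¹ * A' * (A t)⁻¹)) t :=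
  (Matrix.hasFDerivAt_inv ht).comp_hasDerivAt t hA

lemma Matrix.differentiableAt_inv {A : Matrix a a ℝ} (hA : IsUnit A.det) :
    DifferentiableAt ℝ (fun B : Matrix a a ℝ => B⁻¹) A :=
  (Matrix.hasFDerivAt_inv hA).differentiableAt

lemma Matrix.hasDerivAt_exp_smul (A : Matrix a a ℝ) :
    HasDerivAt (fun t : ℝ => NormedSpace.exp (t • A)) A 0 := by
  have h := hasDerivAt_exp_smul_const A (0 : ℝ)
  rw [zero_smul, NormedSpace.exp_zero, one_mul] at h
  exact h

end NormedRing

namespace SymplecticStiefel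

/-! ### Curves in the symplectic Stiefel manifold -/

variable {k n : ℕ} {X : Amb k n} {ρ : ℝ}

/-- A Hamiltonian `A` satisfies `Aᵀ = J(-A)J⁻¹`, so `exp(A)ᵀ = J exp(A)⁻¹ J⁻¹` and `exp(A)` is
symplectic. -/
lemma exp_mul_mem_Sp (hX : X ∈ Sp k n) {A : Matrix (Fin n ⊕ Fin n) (Fin n ⊕ Fin n) ℝ}
    (hA : Aᵀ * J n = -(J n * A)) : NormedSpace.exp A * X ∈ Sp k n := by
  have hJ : IsUnit (J n) := IsUnit.of_mul_eq_one (-J n) (by rw [Matrix.mul_neg, J_mul_J, neg_neg])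
  have hJd := (Matrix.isUnit_iff_isUnit_det _).1 hJ
  have h1 : Aᵀ = J n * (-A) * (J n)⁻¹ := by
    rw [Matrix.mul_neg, ← hA, Matrix.mul_assoc, Matrix.mul_nonsing_inv _ hJd, Matrix.mul_one]
  have h2 : (NormedSpace.exp A)ᵀ * J n * NormedSpace.exp A = J n := by
    rw [← Matrix.exp_transpose, h1, Matrix.exp_conj _ _ hJ, Matrix.mul_assoc _ _ (J n),
      Matrix.nonsing_inv_mul _ hJd, Matrix.mul_one, Matrix.exp_neg, Matrix.mul_assoc,
      Matrix.nonsing_inv_mul _ ((Matrix.isUnit_iff_isUnit_det _).1 (Matrix.isUnit_exp A)),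
      Matrix.mul_one]
  have hX' : Xᵀ * J n * X = J k := hX
  change (NormedSpace.exp A * X)ᵀ * J n * (NormedSpace.exp A * X) = J k
  calc (NormedSpace.exp A * X)ᵀ * J n * (NormedSpace.exp A * X)
      = Xᵀ * ((NormedSpace.exp A)ᵀ * J n * NormedSpace.exp A) * X := by
        simp only [Matrix.transpose_mul, Matrix.mul_assoc]
    _ = J k := by rw [h2, hX']

lemma exists_hamiltonian (hX : X ∈ Sp k n) {Z : Amb k n} (hZ : Z ∈ TSp X) :
    ∃ A : Matrix (Fin n ⊕ Fin n) (Fin n ⊕ Fin n) ℝ, Aᵀ * J n = -(J n * A) ∧ A * X = Z := by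
  have h := mem_TSp_iff.1 hZ
  simp only [Matrix.transpose_mul, Matrix.transpose_transpose, J_transpose,
    Matrix.mul_neg, Matrix.neg_mul, Matrix.mul_assoc] at h
  have h' : Zᵀ * (J n * X) = -(Xᵀ * (J n * Z)) := by rw [← h, neg_neg]
  -- The matrix `(symmetric)·J` is Hamiltonian. Applied to `X`, the term `B(XJ)ᵀJX` returns `B`, and
  -- tangency makes the other term return exactly the half subtracted here.
  set B := Z - (1 / 2 : ℝ) • (X * J k * Xᵀ * (J n)ᵀ * Z) with hB
  refine ⟨(B * (X * J k)ᵀ + X * J k * Bᵀ) * J n, ?_, ?_⟩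
  · simp only [Matrix.transpose_mul, Matrix.transpose_add, Matrix.transpose_neg,
      Matrix.transpose_transpose, J_transpose, Matrix.mul_add, Matrix.add_mul,
      Matrix.mul_neg, Matrix.neg_mul, Matrix.mul_assoc]
    abel
  · simp only [hB, Matrix.transpose_mul, Matrix.transpose_sub, Matrix.transpose_smul,
      Matrix.transpose_neg, Matrix.transpose_transpose, J_transpose, Matrix.add_mul,
      Matrix.mul_sub, Matrix.sub_mul, Matrix.mul_smul, Matrix.smul_mul, Matrix.mul_neg,
      Matrix.neg_mul, Matrix.mul_assoc, J_mul_J, transpose_J_self hX,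
      h', Matrix.mul_one]
    module

/-- Every tangent vector is the velocity of a curve in `Sp(2k,2n)`. -/
lemma exists_curve (hX : X ∈ Sp k n) {Z : Amb k n} (hZ : Z ∈ TSp X) :
    ∃ γ : ℝ → Amb k n, γ 0 = X ∧ (∀ t, γ t ∈ Sp k n) ∧ HasDerivAt γ Z 0 := by
  obtain ⟨A, hA, rfl⟩ := exists_hamiltonian hX hZ
  refine ⟨fun t => NormedSpace.exp (t • A) * X, by simp, fun t => exp_mul_mem_Sp hX ?_, ?_⟩
  · rw [Matrix.transpose_smul, Matrix.smul_mul, hA, Matrix.mul_smul, smul_neg]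
  · simpa using (Matrix.hasDerivAt_exp_smul A).matrix_mul (hasDerivAt_const (0 : ℝ) X)

section Tder

variable {F : Type} [NormedAddCommGroup F] [NormedSpace ℝ F]

lemma IsCr.differentiableWithinAt {r : ℕ} {V : Amb k n → F} (hV : IsCr r V) (hr : r ≠ 0)
    (hX : X ∈ Sp k n) : DifferentiableWithinAt ℝ V (Sp k n) X := by
  obtain ⟨W, hW, h⟩ := hV X hX
  exact ((hW.differentiableAt (by exact_mod_cast hr)).differentiableWithinAt).congr_of_eventuallyEq
    h (h.self_of_nhdsWithin hX)

/-- Reduces derivatives within the manifold to one variable, where derivatives are unique; in the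
ambient space they are determined only on tangent vectors. -/
lemma hasDerivAt_tder {V : Amb k n → F} (hV : DifferentiableWithinAt ℝ V (Sp k n) X)
    {γ : ℝ → Amb k n} {Z : Amb k n} (h0 : γ 0 = X) (hγ : ∀ t, γ t ∈ Sp k n)
    (hZ : HasDerivAt γ Z 0) : HasDerivAt (fun t => V (γ t)) (tder V X Z) 0 :=
  hV.hasFDerivWithinAt.comp_hasDerivAt_of_eq 0 hZ (Filter.Eventually.of_forall hγ) h0.symm

/-- On tangent vectors, `tder` is the derivative of any differentiable local extension. -/
lemma tder_eq_fderiv {V W : Amb k n → F} (hX : X ∈ Sp k n) (hW : DifferentiableAt ℝ W X)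
    (h : V =ᶠ[𝓝[Sp k n] X] W) {Z : Amb k n} (hZ : Z ∈ TSp X) :
    tder V X Z = fderiv ℝ W X Z := by
  obtain ⟨γ, h0, hγ, hd⟩ := exists_curve hX hZ
  have hV : HasFDerivWithinAt V (fderiv ℝ W X) (Sp k n) X :=
    hW.hasFDerivAt.hasFDerivWithinAt.congr_of_eventuallyEq h (h.self_of_nhdsWithin hX)
  exact (hasDerivAt_tder hV.differentiableWithinAt h0 hγ hd).unique
    (hV.comp_hasDerivAt_of_eq 0 hd (Filter.Eventually.of_forall hγ) h0.symm)

end Tder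

/-! ### The derivative of the metric -/

lemma differentiableAt_metricField (ρ : ℝ) (hX : X ∈ Sp k n) :
    DifferentiableWithinAt ℝ (metricField ρ : Amb k n → _) (Sp k n) X := by
  have hid : DifferentiableWithinAt ℝ (fun Y : Amb k n => Y) (Sp k n) X :=
    differentiableWithinAt_id
  have hc : ∀ {c d : Type} [Fintype c] [Fintype d] (A : Matrix c d ℝ),
      DifferentiableWithinAt ℝ (fun _ : Amb k n => A) (Sp k n) X :=
    fun A => differentiableWithinAt_const A
  have hK : DifferentiableWithinAt ℝ (fun Y : Amb k n => (Yᵀ * Y)⁻¹) (Sp k n) X :=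
    DifferentiableAt.comp_differentiableWithinAt (f := fun Y : Amb k n => Yᵀ * Y) X
      (Matrix.differentiableAt_inv (isUnit_gram hX)) (hid.matrix_transpose.matrix_mul hid)
  exact (((((hc (J n)).matrix_mul hid).matrix_mul hid.matrix_transpose).matrix_mul
    (hc (J n)ᵀ)).const_smul (1 / ρ)).add
      ((hc 1).sub ((hid.matrix_mul hK).matrix_mul hid.matrix_transpose))

lemma hasDerivAt_metricField (ρ : ℝ) (hX : X ∈ Sp k n) {γ : ℝ → Amb k n} {Z : Amb k n}
    (h0 : γ 0 = X) (hZ : HasDerivAt γ Z 0) :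
    HasDerivAt (fun t => metricField ρ (γ t)) (metricDeriv ρ X Z) 0 := by
  have hK := (hZ.matrix_transpose.matrix_mul hZ).matrix_inv (by rw [h0]; exact isUnit_gram hX)
  have h := (((((hasDerivAt_const 0 (J n)).matrix_mul hZ).matrix_mul
    hZ.matrix_transpose).matrix_mul (hasDerivAt_const 0 (J n)ᵀ)).const_smul (1 / ρ)).add
      ((hasDerivAt_const 0 (1 : Matrix (Fin n ⊕ Fin n) (Fin n ⊕ Fin n) ℝ)).sub
        ((hZ.matrix_mul hK).matrix_mul hZ.matrix_transpose))
  refine h.congr_deriv ?_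
  subst h0
  simp only [metricDeriv, Matrix.mul_add, Matrix.add_mul, Matrix.mul_sub, Matrix.sub_mul,
    Matrix.mul_neg, Matrix.neg_mul, Matrix.zero_mul, Matrix.mul_zero, Matrix.mul_one,
    Matrix.one_mul, Matrix.mul_assoc]
  module

/-! ### The Riemannian connection -/

lemma metricDeriv_comb (ρ : ℝ) (X Z Z' : Amb k n) (a b : ℝ) :
    metricDeriv ρ X (a • Z + b • Z') = a • metricDeriv ρ X Z + b • metricDeriv ρ X Z' := by
  simp only [metricDeriv, Matrix.mul_add, Matrix.add_mul, Matrix.mul_smul, Matrix.smul_mul,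
    Matrix.transpose_add, Matrix.transpose_smul, Matrix.mul_assoc]
  module

lemma metricDual_comb (ρ : ℝ) (X Z Z' V : Amb k n) (a b : ℝ) :
    metricDual ρ X (a • Z + b • Z') V = a • metricDual ρ X Z V + b • metricDual ρ X Z' V := by
  simp only [metricDual, Matrix.mul_add, Matrix.add_mul, Matrix.mul_smul, Matrix.smul_mul,
    Matrix.transpose_add, Matrix.transpose_smul, Matrix.mul_assoc]
  module

lemma metricDual_comm (ρ : ℝ) (X Z V : Amb k n) : metricDual ρ X Z V = metricDual ρ X V Z := by
  simp only [metricDual]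
  abel_nf

lemma transpose_residual (X : Amb k n) :
    (1 - X * (Xᵀ * X)⁻¹ * Xᵀ)ᵀ = 1 - X * (Xᵀ * X)⁻¹ * Xᵀ := by
  simp only [Matrix.transpose_sub, Matrix.transpose_one, Matrix.transpose_mul,
    Matrix.transpose_transpose, transpose_gram_inv, Matrix.mul_assoc]

lemma metricDeriv_transpose (ρ : ℝ) (X Z : Amb k n) :
    (metricDeriv ρ X Z)ᵀ = metricDeriv ρ X Z := by
  have h := transpose_residual X
  unfold metricDeriv
  generalize 1 - X * (Xᵀ * X)⁻¹ * Xᵀ = R at h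
  simp only [Matrix.transpose_sub, Matrix.transpose_smul, Matrix.transpose_add,
    Matrix.transpose_mul, Matrix.transpose_transpose, transpose_gram_inv, h, Matrix.mul_add,
    Matrix.add_mul, Matrix.mul_assoc]
  abel_nf

lemma trace_metricDual (ρ : ℝ) (X Z V W : Amb k n) :
    ((metricDual ρ X Z V)ᵀ * W).trace = (Zᵀ * metricDeriv ρ X W * V).trace := by
  have h := transpose_residual X
  unfold metricDeriv metricDual
  generalize 1 - X * (Xᵀ * X)⁻¹ * Xᵀ = R at h
  -- `cyc` rotates the trace for the terms of the dual matrix; `tr` transposes the terms of `DM[W]`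
  -- that contain `Wᵀ`.
  have cyc : ∀ (A B : Matrix (Fin n ⊕ Fin n) (Fin n ⊕ Fin n) ℝ)
      (L : Matrix (Fin k ⊕ Fin k) (Fin n ⊕ Fin n) ℝ) (U U' : Amb k n),
      (L * (A * (U * (U'ᵀ * (B * W))))).trace = (U'ᵀ * (B * (W * (L * (A * U))))).trace := by
    intro A B L U U'
    simpa only [Matrix.mul_assoc] using Matrix.trace_mul_comm (L * A * U) (U'ᵀ * B * W)
  have tr : ∀ (A B : Matrix (Fin n ⊕ Fin n) (Fin n ⊕ Fin n) ℝ)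
      (L : Matrix (Fin n ⊕ Fin n) (Fin k ⊕ Fin k) ℝ) (U U' : Amb k n),
      (U'ᵀ * (A * (L * (Wᵀ * (B * U))))).trace = (Uᵀ * (Bᵀ * (W * (Lᵀ * (Aᵀ * U'))))).trace := by
    intro A B L U U'
    rw [← Matrix.trace_transpose]
    simp only [Matrix.transpose_mul, Matrix.transpose_transpose, Matrix.mul_assoc]
  have e1 := cyc (J n)ᵀ (J n) Xᵀ V Z
  have e2 := cyc (J n)ᵀ (J n) Xᵀ Z V
  have e3 := cyc 1 R ((Xᵀ * X)⁻¹ * Xᵀ) V Z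
  have e4 := cyc 1 R ((Xᵀ * X)⁻¹ * Xᵀ) Z V
  have t2 := tr (J n) (J n)ᵀ X V Z
  have t4 := tr 1 R (X * (Xᵀ * X)⁻¹) V Z
  simp only [Matrix.transpose_mul, Matrix.transpose_transpose, transpose_gram_inv, h,
    Matrix.transpose_one, Matrix.one_mul, Matrix.mul_assoc] at e1 e2 e3 e4 t2 t4
  simp only [Matrix.transpose_sub, Matrix.transpose_smul, Matrix.transpose_add,
    Matrix.transpose_mul, Matrix.transpose_transpose, transpose_gram_inv, h, Matrix.mul_add,
    Matrix.add_mul, Matrix.mul_sub, Matrix.sub_mul, Matrix.smul_mul, Matrix.mul_smul,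
    Matrix.mul_assoc, Matrix.trace_add, Matrix.trace_sub, Matrix.trace_smul,
    e1, e2, e3, e4, t2, t4]

/-- The Christoffel term of the ambient metric `metricField`. -/
noncomputable def christoffel (ρ : ℝ) (X Z V : Amb k n) : Amb k n :=
  (1 / 2 : ℝ) • (metricDeriv ρ X Z * V) + (1 / 2 : ℝ) • (metricDeriv ρ X V * Z) -
    (1 / 2 : ℝ) • metricDual ρ X Z V

lemma christoffel_comm (ρ : ℝ) (X Z V : Amb k n) : christoffel ρ X Z V = christoffel ρ X V Z := by
  rw [christoffel, christoffel, metricDual_comm ρ X Z V]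
  module

lemma christoffel_comb (ρ : ℝ) (X Z Z' V : Amb k n) (a b : ℝ) :
    christoffel ρ X (a • Z + b • Z') V = a • christoffel ρ X Z V + b • christoffel ρ X Z' V := by
  simp only [christoffel, metricDeriv_comb, metricDual_comb, Matrix.add_mul, Matrix.smul_mul,
    Matrix.mul_add, Matrix.mul_smul]
  module

lemma christoffel_add (ρ : ℝ) (X Z V W : Amb k n) :
    christoffel ρ X Z (V + W) = christoffel ρ X Z V + christoffel ρ X Z W := by
  have := christoffel_comb ρ X V W Z 1 1
  simp only [one_smul] at this
  rw [christoffel_comm, this, christoffel_comm ρ X V, christoffel_comm ρ X W]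

lemma christoffel_smul (ρ : ℝ) (X Z V : Amb k n) (a : ℝ) :
    christoffel ρ X Z (a • V) = a • christoffel ρ X Z V := by
  have := christoffel_comb ρ X V 0 Z a 0
  simp only [zero_smul, add_zero] at this
  rw [christoffel_comm, this, christoffel_comm ρ X V]

/-- The Levi-Civita connection of the canonical-like metric: the tangential part of the
Levi-Civita connection of the ambient metric `metricField`. -/
noncomputable def leviCivita (ρ : ℝ) (X Z : Amb k n) (V : Amb k n → Amb k n) : Amb k n :=
  projC X (tder V X Z + metricInv ρ X * christoffel ρ X Z (V X))

/-- The Koszul form of the connection: against a tangent `W` the projection can be dropped, and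
`M⁻¹` cancels `M`. -/
lemma trace_leviCivita (hρ : 0 < ρ) (hX : X ∈ Sp k n) (Z : Amb k n) (V : Amb k n → Amb k n)
    {W : Amb k n} (hW : W ∈ TSp X) :
    ((leviCivita ρ X Z V)ᵀ * metricField ρ X * W).trace =
      ((tder V X Z)ᵀ * metricField ρ X * W).trace +
        1 / 2 * ((V X)ᵀ * metricDeriv ρ X Z * W).trace +
        1 / 2 * (Zᵀ * metricDeriv ρ X (V X) * W).trace -
        1 / 2 * (Zᵀ * metricDeriv ρ X W * V X).trace := by
  have h1 := trace_normal (ρ := ρ) hX (tder V X Z + metricInv ρ X * christoffel ρ X Z (V X)) hW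
  rw [Matrix.transpose_sub, Matrix.sub_mul, Matrix.sub_mul, Matrix.trace_sub, sub_eq_zero] at h1
  have h2 : (metricInv ρ X)ᵀ * metricField ρ X = 1 := by
    have := congrArg Matrix.transpose (metricField_mul_metricInv hρ hX)
    rwa [Matrix.transpose_mul, metricField_transpose, Matrix.transpose_one] at this
  rw [leviCivita, ← h1, Matrix.transpose_add, Matrix.add_mul, Matrix.add_mul,
    Matrix.trace_add, Matrix.transpose_mul, Matrix.mul_assoc _ _ (metricField ρ X), h2,
    Matrix.mul_one, christoffel, ← trace_metricDual ρ X Z (V X) W]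
  simp only [Matrix.transpose_sub, Matrix.transpose_add, Matrix.transpose_smul,
    Matrix.transpose_mul, metricDeriv_transpose, Matrix.sub_mul, Matrix.add_mul, Matrix.smul_mul,
    Matrix.trace_sub, Matrix.trace_add, Matrix.trace_smul, smul_eq_mul]
  ring

section Product

variable {F : Type} [NormedAddCommGroup F] [NormedSpace ℝ F]

lemma tder_add (hX : X ∈ Sp k n) {Z : Amb k n} (hZ : Z ∈ TSp X) {V W : Amb k n → F}
    (hV : DifferentiableWithinAt ℝ V (Sp k n) X) (hW : DifferentiableWithinAt ℝ W (Sp k n) X) :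
    tder (fun Y => V Y + W Y) X Z = tder V X Z + tder W X Z := by
  obtain ⟨γ, h0, hγ, hd⟩ := exists_curve hX hZ
  exact (hasDerivAt_tder (hV.add hW) h0 hγ hd).unique
    ((hasDerivAt_tder hV h0 hγ hd).add (hasDerivAt_tder hW h0 hγ hd))

lemma tder_smul (hX : X ∈ Sp k n) {Z : Amb k n} (hZ : Z ∈ TSp X) {φ : Amb k n → ℝ}
    {V : Amb k n → F}
    (hφ : DifferentiableWithinAt ℝ φ (Sp k n) X) (hV : DifferentiableWithinAt ℝ V (Sp k n) X) :
    tder (fun Y => φ Y • V Y) X Z = φ X • tder V X Z + tder φ X Z • V X := by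
  obtain ⟨γ, h0, hγ, hd⟩ := exists_curve hX hZ
  have h := (hasDerivAt_tder hφ h0 hγ hd).smul (hasDerivAt_tder hV h0 hγ hd)
  rw [h0] at h
  exact (hasDerivAt_tder (hφ.smul hV) h0 hγ hd).unique h

end Product

lemma IsC1Field.differentiableWithinAt {V : Amb k n → Amb k n} (hV : IsC1Field V)
    (hX : X ∈ Sp k n) : DifferentiableWithinAt ℝ V (Sp k n) X :=
  hV.1.differentiableWithinAt one_ne_zero hX

/-- The derivative of a tangent field satisfies the linearized tangency condition. -/
lemma tder_tangency {V : Amb k n → Amb k n} (hV : IsC1Field V) (hX : X ∈ Sp k n) {Z : Amb k n}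
    (hZ : Z ∈ TSp X) :
    Zᵀ * J n * V X + Xᵀ * J n * tder V X Z + ((tder V X Z)ᵀ * J n * X + (V X)ᵀ * J n * Z) = 0 := by
  obtain ⟨γ, h0, hγ, hd⟩ := exists_curve hX hZ
  have hV' := hasDerivAt_tder (hV.differentiableWithinAt hX) h0 hγ hd
  have hJ := hasDerivAt_const (0 : ℝ) (J n)
  have h := ((hd.matrix_transpose.matrix_mul hJ).matrix_mul hV').add
    ((hV'.matrix_transpose.matrix_mul hJ).matrix_mul hd)
  have hz : (fun t => (γ t)ᵀ * J n * V (γ t) + (V (γ t))ᵀ * J n * γ t) = fun _ => 0 :=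
    funext fun t => hV.2 _ (hγ t)
  have h' := h.unique ((hasDerivAt_const (0 : ℝ) _).congr_of_eventuallyEq
    (Filter.Eventually.of_forall fun t => congrFun hz t))
  simpa only [h0, Matrix.mul_zero, add_zero] using h'

/-- Subtract the two linearized tangency conditions: the terms free of derivatives are symmetric in
`V` and `W`, and cancel. -/
lemma lie_mem_TSp {V W : Amb k n → Amb k n} (hV : IsC1Field V) (hW : IsC1Field W)
    (hX : X ∈ Sp k n) : tder W X (V X) - tder V X (W X) ∈ TSp X := by
  have h1 := tder_tangency hV hX (hW.2 X hX)
  have h2 := tder_tangency hW hX (hV.2 X hX)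
  have h3 := congrArg₂ (· - ·) h2 h1
  simp only [sub_zero] at h3
  change _ = _
  rw [← h3, Matrix.transpose_sub, Matrix.mul_sub, Matrix.sub_mul, Matrix.sub_mul]
  abel

section Metric

variable {Xperp : Amb k n → Matrix (Fin n ⊕ Fin n) (Fin (2 * n - 2 * k)) ℝ}

lemma canonicalMetric_eq (hkn : k ≤ n) (ρ : ℝ)
    (hXperp : ∀ X ∈ Sp k n, IsNormalizedComplement X (Xperp X)) (hX : X ∈ Sp k n)
    (Z₁ Z₂ : Amb k n) :
    canonicalMetric ρ Xperp X Z₁ Z₂ = (Z₁ᵀ * metricField ρ X * Z₂).trace := by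
  rw [canonicalMetric, metricMatrix_eq hkn ρ hX (hXperp X hX)]

lemma trace_metricField_comm (ρ : ℝ) (X Z₁ Z₂ : Amb k n) :
    (Z₁ᵀ * metricField ρ X * Z₂).trace = (Z₂ᵀ * metricField ρ X * Z₁).trace := by
  rw [← Matrix.trace_transpose]
  simp only [Matrix.transpose_mul, metricField_transpose, Matrix.transpose_transpose,
    Matrix.mul_assoc]

lemma canonicalMetric_definite (hkn : k ≤ n) (hρ : 0 < ρ)
    (hXperp : ∀ X ∈ Sp k n, IsNormalizedComplement X (Xperp X)) (hX : X ∈ Sp k n)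
    {D : Amb k n} (h : canonicalMetric ρ Xperp X D D = 0) : D = 0 := by
  have hM := metricMatrix_posDef hkn hρ hX (hXperp X hX)
  have h1 := hM.posSemidef.conjTranspose_mul_mul_same D
  rw [canonicalMetric, ← Matrix.conjTranspose_eq_transpose_of_trivial, h1.trace_eq_zero_iff] at h
  ext i j
  by_contra hne
  have hcol : (fun i => D i j) ≠ 0 := fun h0 => hne (congrFun h0 i)
  have h2 := hM.dotProduct_mulVec_pos hcol
  have h3 := congrFun (congrFun h j) j
  refine h2.ne' ?_
  rw [← Matrix.zero_apply j j, ← h3, Matrix.mul_assoc]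
  rfl

/-- Existence of the Riemannian connection. -/
theorem isRiemannianConnection_leviCivita (hkn : k ≤ n) (hρ : 0 < ρ)
    (hXperp : ∀ X ∈ Sp k n, IsNormalizedComplement X (Xperp X)) :
    IsRiemannianConnection (canonicalMetric ρ Xperp) (leviCivita ρ) where
  tangent X hX Z _ V _ := projC_mem hX _
  linear_dir X _ Z _ Z' _ a b V _ := by
    simp only [leviCivita]
    rw [christoffel_comb, ← projC_smul, ← projC_smul, ← projC_add]
    congr 1
    simp only [tder, map_add, map_smul, Matrix.mul_add, Matrix.mul_smul]
    module
  add_field X hX Z hZ V W hV hW := by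
    simp only [leviCivita]
    rw [tder_add hX hZ (hV.differentiableWithinAt hX) (hW.differentiableWithinAt hX),
      christoffel_add, ← projC_add, Matrix.mul_add]
    congr 1
    abel
  leibniz X hX Z hZ φ hφ V hV := by
    simp only [leviCivita]
    rw [tder_smul hX hZ (hφ.differentiableWithinAt one_ne_zero hX) (hV.differentiableWithinAt hX),
      christoffel_smul]
    have e : φ X • tder V X Z + tder φ X Z • V X + metricInv ρ X * φ X • christoffel ρ X Z (V X) =
        φ X • (tder V X Z + metricInv ρ X * christoffel ρ X Z (V X)) + tder φ X Z • V X := by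
      rw [Matrix.mul_smul]
      module
    rw [e, projC_add, projC_smul, projC_smul, projC_of_mem (hV.2 X hX)]
  torsion_free X hX V W hV hW := by
    simp only [leviCivita]
    rw [← projC_sub, christoffel_comm ρ X (W X) (V X), add_sub_add_right_eq_sub,
      projC_of_mem (lie_mem_TSp hV hW hX)]
  metric X hX Z hZ V W hV hW := by
    obtain ⟨γ, h0, hγ, hd⟩ := exists_curve hX hZ
    have hVd := hV.differentiableWithinAt hX
    have hWd := hW.differentiableWithinAt hX
    have hMd := differentiableAt_metricField ρ hX
    have hgd : DifferentiableWithinAt ℝ (fun Y => canonicalMetric ρ Xperp Y (V Y) (W Y))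
        (Sp k n) X :=
      ((hVd.matrix_transpose.matrix_mul hMd).matrix_mul hWd).matrix_trace.congr
        (fun Y hY => canonicalMetric_eq hkn ρ hXperp hY _ _)
        (canonicalMetric_eq hkn ρ hXperp hX _ _)
    have h1 := hasDerivAt_tder hgd h0 hγ hd
    have hV' := hasDerivAt_tder hVd h0 hγ hd
    have hW' := hasDerivAt_tder hWd h0 hγ hd
    have h2 := ((hV'.matrix_transpose.matrix_mul
      (hasDerivAt_metricField ρ hX h0 hd)).matrix_mul hW').matrix_trace
    have h3 := h1.unique (h2.congr_of_eventuallyEq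
      (Filter.Eventually.of_forall fun t => canonicalMetric_eq hkn ρ hXperp (hγ t) _ _))
    -- In the sum of the two Koszul forms the halves of `DM[Z]` add up, while the `DM[V]` and
    -- `DM[W]` terms cancel.
    rw [h3, canonicalMetric_eq hkn ρ hXperp hX, canonicalMetric_eq hkn ρ hXperp hX,
      trace_metricField_comm ρ X (V X), trace_leviCivita hρ hX Z V (hW.2 X hX),
      trace_leviCivita hρ hX Z W (hV.2 X hX), h0, Matrix.add_mul, Matrix.trace_add,
      Matrix.trace_add, trace_metricField_comm ρ X (V X) (tder W X Z)]
    have h4 : ((W X)ᵀ * metricDeriv ρ X Z * V X).trace =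
        ((V X)ᵀ * metricDeriv ρ X Z * W X).trace := by
      rw [← Matrix.trace_transpose]
      simp only [Matrix.transpose_mul, metricDeriv_transpose, Matrix.transpose_transpose,
        Matrix.mul_assoc]
    rw [h4]
    ring

/-- Extends any tangent vector to a global tangent field, as uniqueness of the connection requires.
-/
lemma isC1Field_projC (k n : ℕ) (W : Amb k n) : IsC1Field (fun Y : Amb k n => projC Y W) := by
  refine ⟨fun X _ => ⟨fun Y => projC Y W, ?_, Filter.EventuallyEq.rfl⟩, fun X hX => projC_mem hX W⟩
  have hid : ContDiffAt ℝ (1 : ℕ) (fun Y : Amb k n => Y) X := contDiffAt_id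
  have hA : ContDiffAt ℝ (1 : ℕ) (fun Y : Amb k n => Yᵀ * (J n)ᵀ * W) X :=
    (hid.matrix_transpose.matrix_mul contDiffAt_const).matrix_mul contDiffAt_const
  exact contDiffAt_const.sub ((hid.matrix_mul contDiffAt_const).matrix_mul
    ((hA.sub hA.matrix_transpose).const_smul (1 / 2 : ℝ)))

/-- Uniqueness of the Riemannian connection. -/
theorem IsRiemannianConnection.unique (hkn : k ≤ n) (hρ : 0 < ρ)
    (hXperp : ∀ X ∈ Sp k n, IsNormalizedComplement X (Xperp X))
    {con con' : Amb k n → Amb k n → (Amb k n → Amb k n) → Amb k n}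
    (hc : IsRiemannianConnection (canonicalMetric ρ Xperp) con)
    (hc' : IsRiemannianConnection (canonicalMetric ρ Xperp) con')
    (hX : X ∈ Sp k n) {Z : Amb k n} (hZ : Z ∈ TSp X) {V : Amb k n → Amb k n} (hV : IsC1Field V) :
    con X Z V = con' X Z V := by
  -- The difference of the two connections, paired with a third field. Metric compatibility makes it
  -- skew in the last two arguments and torsion-freeness symmetric in the first two, so six swaps
  -- give `t = -t`.
  let t : (Amb k n → Amb k n) → (Amb k n → Amb k n) → (Amb k n → Amb k n) → ℝ := fun Z V W =>
    ((con X (Z X) V - con' X (Z X) V)ᵀ * metricField ρ X * W X).trace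
  have hanti : ∀ Z V W, IsC1Field Z → IsC1Field V → IsC1Field W → t Z V W = -t Z W V := by
    intro Z V W hZ hV hW
    have h1 := hc.metric X hX _ (hZ.2 X hX) V W hV hW
    rw [hc'.metric X hX _ (hZ.2 X hX) V W hV hW] at h1
    simp only [canonicalMetric_eq hkn ρ hXperp hX, trace_metricField_comm ρ X (V X)] at h1
    simp only [t, Matrix.transpose_sub, Matrix.sub_mul, Matrix.trace_sub]
    linarith
  have hsymm : ∀ Z V W, IsC1Field Z → IsC1Field V → IsC1Field W → t Z V W = t V Z W := by
    intro Z V W hZ hV _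
    have h1 := hc.torsion_free X hX Z V hZ hV
    rw [← hc'.torsion_free X hX Z V hZ hV] at h1
    have h2 : con X (Z X) V - con' X (Z X) V = con X (V X) Z - con' X (V X) Z := by
      rw [sub_eq_sub_iff_sub_eq_sub, h1]
    simp only [t, h2]
  have hzero : ∀ Z V W, IsC1Field Z → IsC1Field V → IsC1Field W → t Z V W = 0 := by
    intro Z V W hZ hV hW
    have h1 := hsymm Z V W hZ hV hW
    have h2 := hanti V Z W hV hZ hW
    have h3 := hsymm V W Z hV hW hZ
    have h4 := hanti W V Z hW hV hZ
    have h5 := hsymm W Z V hW hZ hV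
    have h6 := hanti Z W V hZ hW hV
    linarith
  have hD : con X Z V - con' X Z V ∈ TSp X := by
    have h1 := hc.tangent X hX Z hZ V hV
    have h2 := hc'.tangent X hX Z hZ V hV
    rw [mem_TSp_iff] at h1 h2 ⊢
    rw [Matrix.mul_sub, Matrix.mul_sub, Matrix.transpose_sub, h1, h2]
  -- Testing against the difference itself gives its squared norm.
  have h := hzero _ V _ (isC1Field_projC k n Z) hV
    (isC1Field_projC k n (con X Z V - con' X Z V))
  simp only [t, projC_of_mem hZ, projC_of_mem hD] at h
  rw [← canonicalMetric_eq hkn ρ hXperp hX] at h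
  exact sub_eq_zero.1 (canonicalMetric_definite hkn hρ hXperp hX h)

theorem isRiemannianConnection_riemannianConnection (hkn : k ≤ n) (hρ : 0 < ρ)
    (hXperp : ∀ X ∈ Sp k n, IsNormalizedComplement X (Xperp X)) :
    IsRiemannianConnection (canonicalMetric ρ Xperp)
      (riemannianConnection (canonicalMetric ρ Xperp)) :=
  Classical.epsilon_spec ⟨_, isRiemannianConnection_leviCivita hkn hρ hXperp⟩

end Metric

/-! ### The Riemannian gradient -/

lemma fderiv_eq_trace (fbar : Amb k n → ℝ) (X Z : Amb k n) :
    fderiv ℝ fbar X Z = ((ambientGradient fbar X)ᵀ * Z).trace := by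
  nth_rewrite 1 [Matrix.matrix_eq_sum_single Z]
  simp only [map_sum, Matrix.trace, Matrix.diag_apply, Matrix.mul_apply, Matrix.transpose_apply,
    ambientGradient, Matrix.of_apply]
  rw [Finset.sum_comm]
  refine Finset.sum_congr rfl fun j _ => Finset.sum_congr rfl fun i _ => ?_
  have : Matrix.single i j (Z i j) = Z i j • Matrix.single i j (1 : ℝ) := by
    rw [Matrix.smul_single, smul_eq_mul, mul_one]
  rw [this, map_smul, smul_eq_mul, mul_comm]

/-- The Riesz map sending a linear form on the ambient space to its matrix of coefficients. -/
noncomputable def rieszCLM (k n : ℕ) : (Amb k n →L[ℝ] ℝ) →L[ℝ] Amb k n :=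
  LinearMap.toContinuousLinearMap
    { toFun := fun L => Matrix.of fun i j => L (Matrix.single i j 1)
      map_add' := fun _ _ => rfl
      map_smul' := fun _ _ => rfl }

lemma contDiffAt_ambientGradient {fbar : Amb k n → ℝ} (h : ContDiffAt ℝ 2 fbar X) :
    ContDiffAt ℝ (1 : ℕ) (ambientGradient fbar) X :=
  (rieszCLM k n).contDiff.contDiffAt.comp X (h.fderiv_right (by norm_num))

lemma metricField_mul_self (hX : X ∈ Sp k n) :
    metricField ρ X * (X * J k) = (1 / ρ) • (J n * X) := by
  have h := inv_mul_gram_mul hX (J k)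
  simp only [metricField, J_transpose, Matrix.add_mul, Matrix.sub_mul, Matrix.smul_mul,
    Matrix.mul_neg, Matrix.neg_mul, Matrix.mul_assoc, transpose_J_self_mul hX, J_mul_J, h,
    Matrix.one_mul, Matrix.mul_one]
  module

/-- The normal part of the Euclidean gradient. -/
lemma metricField_mul_projC (hρ : 0 < ρ) (hX : X ∈ Sp k n) (G : Amb k n) :
    metricField ρ X * projC X (metricInv ρ X * G) =
      G - J n * X * skew ((J k)ᵀ * Xᵀ * G) := by
  have h1 : skew (Xᵀ * (J n)ᵀ * (metricInv ρ X * G)) = ρ • skew ((J k)ᵀ * Xᵀ * G) := by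
    rw [← Matrix.mul_assoc, transpose_J_metricInv hX, Matrix.smul_mul, skew, skew,
      Matrix.transpose_smul]
    module
  rw [projC, h1, Matrix.mul_sub, ← Matrix.mul_assoc, metricField_mul_metricInv hρ hX,
    Matrix.one_mul, Matrix.mul_smul, Matrix.mul_smul, ← Matrix.mul_assoc (metricField ρ X),
    metricField_mul_self hX, Matrix.smul_mul, smul_smul, mul_one_div_cancel hρ.ne', one_smul]

section Metric

variable {Xperp : Amb k n → Matrix (Fin n ⊕ Fin n) (Fin (2 * n - 2 * k)) ℝ}

/-- `M` times the candidate is `G - JXΩ`, and `JXΩ` pairs with a tangent `Z` to the trace of skew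
`Ω` times symmetric `XᵀJZ`, which is zero. -/
lemma isRiemannianGradientAt_projC (hkn : k ≤ n) (hρ : 0 < ρ)
    (hXperp : ∀ X ∈ Sp k n, IsNormalizedComplement X (Xperp X)) (hX : X ∈ Sp k n)
    {f fbar : Amb k n → ℝ} (hfbar : DifferentiableAt ℝ fbar X) (hf : f =ᶠ[𝓝[Sp k n] X] fbar) :
    IsRiemannianGradientAt (canonicalMetric ρ Xperp) f X
      (projC X (metricInv ρ X * ambientGradient fbar X)) := by
  refine ⟨projC_mem hX _, fun Z hZ => ?_⟩
  have h2 : (J n * X * skew ((J k)ᵀ * Xᵀ * ambientGradient fbar X))ᵀ * Z =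
      skew ((J k)ᵀ * Xᵀ * ambientGradient fbar X) * (Xᵀ * (J n * Z)) := by
    rw [Matrix.transpose_mul, Matrix.transpose_mul, skew_transpose, J_transpose n]
    simp only [Matrix.mul_neg, Matrix.neg_mul, neg_neg, Matrix.mul_assoc]
  rw [canonicalMetric_eq hkn ρ hXperp hX, tder_eq_fderiv hX hfbar hf hZ, fderiv_eq_trace,
    trace_metricField_comm, Matrix.mul_assoc, metricField_mul_projC hρ hX, ← Matrix.trace_transpose,
    Matrix.transpose_mul, Matrix.transpose_transpose, Matrix.transpose_sub, Matrix.sub_mul, h2,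
    Matrix.trace_sub, trace_skew_mul_symm (skew_transpose _) (mem_TSp_iff.1 hZ), sub_zero]

lemma IsRiemannianGradientAt.unique (hkn : k ≤ n) (hρ : 0 < ρ)
    (hXperp : ∀ X ∈ Sp k n, IsNormalizedComplement X (Xperp X)) (hX : X ∈ Sp k n)
    {f : Amb k n → ℝ} {G G' : Amb k n}
    (hG : IsRiemannianGradientAt (canonicalMetric ρ Xperp) f X G)
    (hG' : IsRiemannianGradientAt (canonicalMetric ρ Xperp) f X G') : G = G' := by
  have hD : G - G' ∈ TSp X := by
    have h1 := hG.1
    have h2 := hG'.1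
    rw [mem_TSp_iff] at h1 h2 ⊢
    rw [Matrix.mul_sub, Matrix.mul_sub, Matrix.transpose_sub, h1, h2]
  refine sub_eq_zero.1 (canonicalMetric_definite hkn hρ hXperp hX ?_)
  have h1 := hG.2 _ hD
  rw [← hG'.2 _ hD] at h1
  rw [canonicalMetric_eq hkn ρ hXperp hX] at h1 ⊢
  rw [canonicalMetric_eq hkn ρ hXperp hX] at h1
  rw [Matrix.transpose_sub, Matrix.sub_mul, Matrix.sub_mul, Matrix.trace_sub, h1, sub_self]

lemma riemannianGradient_eq (hkn : k ≤ n) (hρ : 0 < ρ)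
    (hXperp : ∀ X ∈ Sp k n, IsNormalizedComplement X (Xperp X)) (hX : X ∈ Sp k n)
    {f fbar : Amb k n → ℝ} (hfbar : DifferentiableAt ℝ fbar X) (hf : f =ᶠ[𝓝[Sp k n] X] fbar) :
    riemannianGradient (canonicalMetric ρ Xperp) f X =
      projC X (metricInv ρ X * ambientGradient fbar X) := by
  have h := isRiemannianGradientAt_projC hkn hρ hXperp hX hfbar hf
  exact IsRiemannianGradientAt.unique hkn hρ hXperp hX (Classical.epsilon_spec ⟨_, h⟩) h

/-- The closed form must hold near `X`, and not only at `X`, before the gradient field can be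
differentiated. -/
lemma eventually_riemannianGradient_eq (hkn : k ≤ n) (hρ : 0 < ρ)
    (hXperp : ∀ X ∈ Sp k n, IsNormalizedComplement X (Xperp X))
    {f fbar : Amb k n → ℝ} (hfbar : ContDiffAt ℝ 2 fbar X) (hf : f =ᶠ[𝓝[Sp k n] X] fbar) :
    riemannianGradient (canonicalMetric ρ Xperp) f =ᶠ[𝓝[Sp k n] X]
      fun Y => projC Y (metricInv ρ Y * ambientGradient fbar Y) := by
  have h1 : ∀ᶠ Y in 𝓝[Sp k n] X, DifferentiableAt ℝ fbar Y :=
    ((hfbar.eventually (by simp)).mono fun Y hY =>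
      hY.differentiableAt (by norm_num)).filter_mono nhdsWithin_le_nhds
  filter_upwards [h1, eventually_eventually_nhdsWithin.2 hf, self_mem_nhdsWithin] with Y hY hYf hYS
  exact riemannianGradient_eq hkn hρ hXperp hYS hY hYf

lemma isC1Field_riemannianGradient (hkn : k ≤ n) (hρ : 0 < ρ)
    (hXperp : ∀ X ∈ Sp k n, IsNormalizedComplement X (Xperp X))
    {f : Amb k n → ℝ} (hf : IsCr 2 f) :
    IsC1Field (riemannianGradient (canonicalMetric ρ Xperp) f) := by
  refine ⟨fun X hX => ?_, fun X hX => ?_⟩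
  · obtain ⟨fbar, hfbar, hff⟩ := hf X hX
    refine ⟨_, ?_, eventually_riemannianGradient_eq hkn hρ hXperp hfbar hff⟩
    have hid : ContDiffAt ℝ (1 : ℕ) (fun Y : Amb k n => Y) X := contDiffAt_id
    have hP : ContDiffAt ℝ (1 : ℕ) (fun Y : Amb k n => obliqueProj Y) X :=
      contDiffAt_const.sub (((hid.matrix_mul contDiffAt_const).matrix_mul
        hid.matrix_transpose).matrix_mul contDiffAt_const)
    have hN : ContDiffAt ℝ (1 : ℕ) (fun Y : Amb k n => metricInv ρ Y * ambientGradient fbar Y) X :=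
      (((hid.matrix_mul hid.matrix_transpose).const_smul ρ).add
        (hP.matrix_mul hP.matrix_transpose)).matrix_mul (contDiffAt_ambientGradient hfbar)
    have hA := (hid.matrix_transpose.matrix_mul (contDiffAt_const (c := (J n)ᵀ))).matrix_mul hN
    exact hN.sub ((hid.matrix_mul contDiffAt_const).matrix_mul
      ((hA.sub hA.matrix_transpose).const_smul (1 / 2 : ℝ)))
  · obtain ⟨fbar, hfbar, hff⟩ := hf X hX
    rw [riemannianGradient_eq hkn hρ hXperp hX (hfbar.differentiableAt (by norm_num)) hff]
    exact projC_mem hX _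

/-! ### The Riemannian Hessian -/

/-- `M⁻¹` sends `JXΩ` to the normal vector `ρXJΩ`. -/
lemma projC_normal (hX : X ∈ Sp k n) {Ω : Matrix (Fin k ⊕ Fin k) (Fin k ⊕ Fin k) ℝ}
    (hΩ : Ωᵀ = -Ω) : projC X (metricInv ρ X * (J n * X * Ω)) = 0 := by
  have h : metricInv ρ X * (J n * X * Ω) = ρ • (X * (J k * Ω)) := by
    simp only [metricInv, obliqueProj, J_transpose, Matrix.transpose_sub, Matrix.transpose_neg,
      Matrix.transpose_mul, Matrix.transpose_transpose, Matrix.transpose_one,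
      Matrix.add_mul, Matrix.mul_sub, Matrix.sub_mul, Matrix.mul_neg, Matrix.neg_mul,
      Matrix.mul_assoc, J_mul_J_mul, transpose_J_self_mul hX, Matrix.one_mul, Matrix.smul_mul,
      Matrix.mul_one]
    module
  have h2 : skew (Xᵀ * (J n)ᵀ * (X * (J k * Ω))) = Ω := by
    simp only [skew, J_transpose, Matrix.mul_neg, Matrix.neg_mul, Matrix.mul_assoc,
      transpose_J_self_mul hX, J_mul_J_mul, neg_neg, hΩ]
    module
  rw [h, projC_smul, projC, h2, Matrix.mul_assoc, sub_self, smul_zero]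

/-- The Riemannian Hessian in terms of the derivative of the metric. -/
theorem riemannianHessian_eq (hkn : k ≤ n) (hρ : 0 < ρ)
    (hXperp : ∀ X ∈ Sp k n, IsNormalizedComplement X (Xperp X)) (hX : X ∈ Sp k n)
    {f fbar : Amb k n → ℝ} (hf : IsCr 2 f) (hfbar : ContDiffAt ℝ 2 fbar X)
    (hff : f =ᶠ[𝓝[Sp k n] X] fbar) {Z V G : Amb k n} (hZ : Z ∈ TSp X)
    (hG : G = ambientGradient fbar X) (hV : V = projC X (metricInv ρ X * G)) :
    riemannianHessian (canonicalMetric ρ Xperp) f X Z =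
      projC X (metricInv ρ X * ambientHessian fbar X Z) +
      projC X (metricInv ρ X * (-(J n * Z * skew ((J k)ᵀ * Xᵀ * G))
        - (1 / 2 : ℝ) • (metricDeriv ρ X Z * V)
        + (1 / 2 : ℝ) • (metricDeriv ρ X V * Z) - (1 / 2 : ℝ) • metricDual ρ X Z V)) := by
  have hC1 := isC1Field_riemannianGradient hkn hρ hXperp hf
  rw [riemannianHessian, (isRiemannianConnection_riemannianConnection hkn hρ hXperp).unique hkn hρ
    hXperp (isRiemannianConnection_leviCivita hkn hρ hXperp) hX hZ hC1, leviCivita,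
    riemannianGradient_eq hkn hρ hXperp hX (hfbar.differentiableAt (by norm_num)) hff, ← hG, ← hV]
  obtain ⟨γ, h0, hγ, hd⟩ := exists_curve hX hZ
  have hV' := hasDerivAt_tder (hC1.differentiableWithinAt hX) h0 hγ hd
  set V' := tder (riemannianGradient (canonicalMetric ρ Xperp) f) X Z
  have hG' : HasDerivAt (fun t => ambientGradient fbar (γ t)) (ambientHessian fbar X Z) 0 :=
    (((contDiffAt_ambientGradient hfbar).differentiableAt
      (by norm_num)).hasFDerivAt).comp_hasDerivAt_of_eq 0 hd h0.symm
  have hγt : Filter.Tendsto γ (𝓝 0) (𝓝[Sp k n] X) :=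
    tendsto_nhdsWithin_iff.2 ⟨h0 ▸ hd.continuousAt.tendsto, Filter.Eventually.of_forall hγ⟩
  have hev := hγt.eventually (eventually_riemannianGradient_eq hkn hρ hXperp hfbar hff)
  have hB := ((hasDerivAt_const (0 : ℝ) (J k)ᵀ).matrix_mul hd.matrix_transpose).matrix_mul hG'
  have hΩ' := (hB.sub hB.matrix_transpose).const_smul (1 / 2 : ℝ)
  set B' := ((0 : Matrix (Fin k ⊕ Fin k) (Fin k ⊕ Fin k) ℝ) * (γ 0)ᵀ + (J k)ᵀ * Zᵀ) *
    ambientGradient fbar (γ 0) + (J k)ᵀ * (γ 0)ᵀ * ambientHessian fbar X Z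
  have hlhs := (hasDerivAt_metricField ρ hX h0 hd).matrix_mul hV'
  have hrhs := hG'.sub (((hasDerivAt_const (0 : ℝ) (J n)).matrix_mul hd).matrix_mul hΩ')
  -- Derivative along the curve of the relation `M grad f = G - JX skew(JᵀXᵀG)`.
  have hkey := hlhs.unique (hrhs.congr_of_eventuallyEq (hev.mono fun t ht => by
    change metricField ρ (γ t) * riemannianGradient (canonicalMetric ρ Xperp) f (γ t) = _
    rw [ht, metricField_mul_projC hρ (hγ t)]
    rfl))
  change metricDeriv ρ X Z * riemannianGradient (canonicalMetric ρ Xperp) f (γ 0) +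
    metricField ρ (γ 0) * V' = ambientHessian fbar X Z -
    ((0 * γ 0 + J n * Z) * skew ((J k)ᵀ * (γ 0)ᵀ * ambientGradient fbar (γ 0)) +
      J n * γ 0 * skew B') at hkey
  rw [h0, riemannianGradient_eq hkn hρ hXperp hX (hfbar.differentiableAt (by norm_num)) hff, ← hG,
    ← hV, Matrix.zero_mul, zero_add] at hkey
  have hNM : metricInv ρ X * metricField ρ X = 1 :=
    mul_eq_one_comm.1 (metricField_mul_metricInv hρ hX)
  have hV'eq : V' = metricInv ρ X * (ambientHessian fbar X Z -
      (J n * Z * skew ((J k)ᵀ * Xᵀ * G) + J n * X * skew B') - metricDeriv ρ X Z * V) := by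
    rw [← hkey, add_sub_cancel_left, ← Matrix.mul_assoc, hNM, Matrix.one_mul]
  -- The derivative of the skew multiplier enters only through `JX skew B'`, which `projC_normal`
  -- annihilates.
  rw [hV'eq, ← projC_add, ← sub_eq_zero, ← projC_sub, ← projC_normal (ρ := ρ) hX
    (Ω := -skew B') (by rw [Matrix.transpose_neg, skew_transpose])]
  congr 1
  -- The `-DM[Z]V` from the derivative and the `+½DM[Z]V` of the Christoffel term leave the
  -- coefficient `-½`.
  rw [← Matrix.mul_add, ← Matrix.mul_add, ← Matrix.mul_sub, christoffel, Matrix.mul_neg]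
  congr 1
  module

end Metric

end SymplecticStiefel

/-! ### Assembly of the theorem. -/

open SymplecticStiefel in
theorem theorem3p2 {k n : ℕ} (hk : 1 ≤ k) (hkn : k ≤ n) (ρ : ℝ) (hρ : 0 < ρ)
    (Xperp : Amb k n → Matrix (Fin n ⊕ Fin n) (Fin (2 * n - 2 * k)) ℝ)
    (hXperp : ∀ X ∈ Sp k n, IsNormalizedComplement X (Xperp X))
    (f : Amb k n → ℝ) (hf : IsCr 2 f) :
    -- the metric has a Riemannian connection, and `f` has a gradient field of class `C^1`
    IsRiemannianConnection (canonicalMetric ρ Xperp)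
      (riemannianConnection (canonicalMetric ρ Xperp)) ∧
    (∀ X ∈ Sp k n, IsRiemannianGradientAt (canonicalMetric ρ Xperp) f X
      (riemannianGradient (canonicalMetric ρ Xperp) f X)) ∧
    IsC1Field (riemannianGradient (canonicalMetric ρ Xperp) f) ∧
    ∀ X ∈ Sp k n,
      (metricMatrix ρ X (Xperp X)).PosDef ∧
      -- `P_{X,c}` is the orthogonal projection onto the tangent space
      (∀ Y : Amb k n, projC X Y ∈ TSp X ∧
        ∀ V ∈ TSp X, canonicalMetric ρ Xperp X (Y - projC X Y) V = 0) ∧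
      -- `P_X` is a projection, with values in the tangent space
      obliqueProj X * obliqueProj X = obliqueProj X ∧
      (∀ Y : Amb k n, obliqueProj X * Y ∈ TSp X) ∧
      -- the formula for the Riemannian Hessian
      ∀ fbar : Amb k n → ℝ, ContDiffAt ℝ 2 fbar X → f =ᶠ[nhdsWithin X (Sp k n)] fbar →
      ∀ Z ∈ TSp X, ∀ M P G H, M = metricMatrix ρ X (Xperp X) → P = obliqueProj X →
        G = ambientGradient fbar X → H = ambientHessian fbar X Z →
        riemannianHessian (canonicalMetric ρ Xperp) f X Z =
          projC X
            (M⁻¹ * H - ρ • (Z * J k * skew ((J k)ᵀ * Xᵀ * G))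
              + (2 : ℝ) • (symm (ρ • (X * Zᵀ)
                  - (2 : ℝ) • (skew (X * J k * Zᵀ) * (J n)ᵀ * Pᵀ)) * G)
              + ρ • (X * symm (Xᵀ * J n * Z * Gᵀ * X * J k - Zᵀ * G)))
          + P * (Pᵀ * J n * (Z * symm (Gᵀ * X * J k) + (1 / ρ) • (Pᵀ * G * Zᵀ * J n * X))
              - J n * X * J k * symm (Zᵀ * Pᵀ * G)
              - Z * skew (J k * Xᵀ * J n * Pᵀ * G + ρ • (J k * symm ((J k)ᵀ * Xᵀ * G)))
              - Pᵀ * G * skew ((Xᵀ * X)⁻¹ * Xᵀ * Z)) := by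
  refine ⟨isRiemannianConnection_riemannianConnection hkn hρ hXperp, fun X hX => ?_,
    isC1Field_riemannianGradient hkn hρ hXperp hf, fun X hX =>
    ⟨metricMatrix_posDef hkn hρ hX (hXperp X hX), fun Y => ⟨projC_mem hX Y, fun V hV => ?_⟩,
      obliqueProj_sq hX, obliqueProj_mul_mem hX, ?_⟩⟩
  · obtain ⟨fbar, hfbar, hff⟩ := hf X hX
    exact Classical.epsilon_spec ⟨_, isRiemannianGradientAt_projC hkn hρ hXperp hX
      (hfbar.differentiableAt (by norm_num)) hff⟩
  · rw [canonicalMetric_eq hkn ρ hXperp hX]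
    exact trace_normal hX Y hV
  intro fbar hfbar hff Z hZ M P G H hM hP hG hH
  have hMi : M⁻¹ = metricInv ρ X := by
    rw [hM, metricMatrix_eq hkn ρ hX (hXperp X hX), metricField_inv hρ hX]
  have hPX := obliqueProj_mul_self hX
  -- The coordinates are `T = XᵀJᵀZ`, `F = P_X Z`, `E = P_Xᵀ G`, with `S` and `Ω` the symmetric and
  -- skew parts of `JᵀXᵀG`.
  have hE' : ((obliqueProj X)ᵀ * G)ᵀ * X = 0 := by
    rw [Matrix.transpose_mul, Matrix.transpose_transpose, Matrix.mul_assoc, hPX, Matrix.mul_zero]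
  have hE : Xᵀ * ((obliqueProj X)ᵀ * G) = 0 := by
    simpa using congrArg Matrix.transpose hE'
  have hF := transpose_J_obliqueProj_mul hX Z
  have hF' : (obliqueProj X * Z)ᵀ * (J n * X) = 0 := by
    have := congrArg Matrix.transpose hF
    rw [Matrix.transpose_mul, Matrix.transpose_mul, J_transpose, Matrix.transpose_transpose,
      Matrix.transpose_zero, Matrix.mul_neg, Matrix.neg_mul, neg_eq_zero] at this
    rw [← Matrix.mul_assoc]
    exact this
  have hT : (Xᵀ * (J n)ᵀ * Z)ᵀ = Xᵀ * (J n)ᵀ * Z := by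
    simp only [J_transpose, Matrix.mul_neg, Matrix.neg_mul, Matrix.transpose_neg, Matrix.mul_assoc,
      mem_TSp_iff.1 hZ]
  have hZd : Z = X * J k * (Xᵀ * (J n)ᵀ * Z) + obliqueProj X * Z := by
    simp only [obliqueProj, Matrix.sub_mul, Matrix.one_mul, Matrix.mul_assoc]
    abel
  have hVd : projC X (metricInv ρ X * G) = ρ • (X * J k * symm ((J k)ᵀ * Xᵀ * G)) +
      obliqueProj X * ((obliqueProj X)ᵀ * G) := by
    rw [projC_eq, ← Matrix.mul_assoc _ (metricInv ρ X), transpose_J_metricInv hX,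
      ← Matrix.mul_assoc, obliqueProj_mul_metricInv hX, Matrix.mul_assoc (obliqueProj X)]
    simp only [SymplecticStiefel.symm, Matrix.smul_mul, Matrix.transpose_smul, ← smul_add,
      Matrix.mul_smul]
    rw [smul_comm]
  have hGd : G = J n * X * (symm ((J k)ᵀ * Xᵀ * G) + skew ((J k)ᵀ * Xᵀ * G)) +
      (obliqueProj X)ᵀ * G := by
    have h1 : symm ((J k)ᵀ * Xᵀ * G) + skew ((J k)ᵀ * Xᵀ * G) = (J k)ᵀ * Xᵀ * G := by
      simp only [SymplecticStiefel.symm, skew]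
      module
    rw [h1]
    simp only [obliqueProj, Matrix.transpose_sub, Matrix.transpose_mul, Matrix.transpose_one,
      Matrix.transpose_transpose, Matrix.sub_mul, Matrix.one_mul, Matrix.mul_assoc]
    abel
  have hsymm : symm (Gᵀ * X * J k) = symm ((J k)ᵀ * Xᵀ * G) := by
    simp only [SymplecticStiefel.symm, Matrix.transpose_mul, Matrix.transpose_transpose, Matrix.mul_assoc]
    rw [add_comm]
  have hsplit : ∀ a b c d : Amb k n, a - b + c + d = a + (-b + c + d) := fun a b c d => by abel
  rw [riemannianHessian_eq hkn hρ hXperp hX hf hfbar hff hZ hG rfl, ← hH, hMi, hP, hsymm,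
    hsplit, projC_add, add_assoc (projC X (metricInv ρ X * H))]
  congr 1
  -- The `M⁻¹H` terms already agree; the remaining identity is compared component by component.
  rw [projC_eq X (metricInv ρ X * _), projC_eq X (_ + _),
    hessian_symm_part hρ hX hT (symm_transpose _) (skew_transpose _) hF hF' hE hE' Z _ G hZd hVd hGd,
    hessian_oblique_part hρ hX hT (symm_transpose _) (skew_transpose _) hF hF' hE hE' Z _ G hZd hVd
      hGd]
  simp only [Matrix.mul_assoc, add_assoc]
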